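/- Let $d\ge 1$ and let $M$ be a smooth (Hausdorff, second countable) $d$-manifold without boundary, with a conformal class $\boldsymbol c=[g]=[\Omega^2 g]$ of smooth Riemannian metrics. A (conformal) density of weight $w$ is a class $[g;f]=[\Omega^2g;\Omega^wf]$ with $f\in C^\infty(M)$. Let $\boldsymbol\sigma=[g;\sigma]$ be a defining density for $\Sigma\subset M$: it has weight $1$, its zero locus is $\Sigma$, and $d\sigma\ne0$ at every point of $\Sigma$. A true scale is a strictly positive density $\boldsymbol\tau=[g;\tau]$ of weight $1$. Let $\widetilde D\subset M$ be a compact region with a collar along $\Sigma$: every point of $\widetilde D\cap\Sigma$ has a smooth chart $(U;y_1,\dots,y_d)$ around it and an index $i$ such that $\Sigma\cap U=\{y_i=0\}$ and membership of a point of $U$ in $\widetilde D$ does not depend on its coordinate $y_i$. (For example, $\widetilde D$ is a neighbourhood of a closed hypersurface $\Sigma$, or $\partial\widetilde D$ is smooth and transverse to $\Sigma$.) For a true scale $\boldsymbol\tau$ and $\varepsilon>0$ the regulated volume is $$\mathrm{Vol}_\varepsilon=\int_{\widetilde D}dV^g\,\frac{\theta(\sigma/\tau-\varepsilon)}{\sigma^d},$$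 where $\theta$ is the Heaviside function with $\theta(0)=1$. For a density $\boldsymbol f=[g;f]$ of weight $j+1-d$, the integral $\int_{\widetilde D}\boldsymbol\delta^{(j)}\boldsymbol f$, with $\boldsymbol\delta^{(j)}=[g;\delta^{(j)}(\sigma)]$, means $\lim_{\eta\to0^+}\int_{\widetilde D}dV^g\,\rho_\eta^{(j)}(\sigma)\,f$, where $\rho_\eta(t)=\eta^{-1}\rho(t/\eta)$ and $\rho\in C_c^\infty(\mathbb R)$ has $\int\rho=1$. **Theorem.** The integrals $\int_{\widetilde D}\boldsymbol\delta^{(d-1)}$ and, for every true scale $\boldsymbol\tau$ and $1\le k\le d-1$, $\int_{\widetilde D}\boldsymbol\delta^{(d-1-k)}/\boldsymbol\tau^k$ exist and depend neither on the choice of $g\in\boldsymbol c$ nor on $\rho$. Put $$\mathcal A=\frac{(-1)^d}{(d-1)!}\int_{\widetilde D}\boldsymbol\delta^{(d-1)},\qquad v_k=\frac{(-1)^{d-k-1}}{(d-1-k)!\,k}\int_{\widetilde D}\frac{\boldsymbol\delta^{(d-1-k)}}{\boldsymbol\tau^k}\quad(1\le k\le d-1);$$ in particular $\mathcal A$ does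 not depend on $\boldsymbol\tau$. For every true scale $\boldsymbol\tau$ the integral defining $\mathrm{Vol}_\varepsilon$ converges absolutely for every $\varepsilon>0$ and every $g\in\boldsymbol c$, and there are a constant $\mathrm{Vol}_{\rm ren}\in\mathbb R$, a function $\mathcal R\in C^\infty(\mathbb R)$ and an $\varepsilon_0>0$, all independent of $g\in\boldsymbol c$, such that for all $0<\varepsilon<\varepsilon_0$ $$\mathrm{Vol}_\varepsilon=\sum_{k=1}^{d-1}\frac{v_k}{\varepsilon^k}+\mathcal A\,\log\varepsilon+\mathrm{Vol}_{\rm ren}+\varepsilon\,\mathcal R(\varepsilon).$$ -/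

import Mathlib

open Set Filter Topology MeasureTheory
open scoped Manifold ContDiff Bundle

noncomputable section

/-- Smooth Riemannian metrics on a `d`-dimensional manifold `M` without boundary. -/
abbrev SmoothMetric (d : ℕ) (M : Type*) [TopologicalSpace M]
    [ChartedSpace (EuclideanSpace ℝ (Fin d)) M] [IsManifold (𝓡 d) ∞ M] :=
  Bundle.ContMDiffRiemannianMetric (𝓡 d) ∞ (EuclideanSpace ℝ (Fin d))
    (fun x : M => TangentSpace (𝓡 d) x)

section Volume

variable {d : ℕ} {M : Type*} [TopologicalSpace M]
  [ChartedSpace (EuclideanSpace ℝ (Fin d)) M] [IsManifold (𝓡 d) ∞ M]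

/-- The Gram matrix `g_ij = g(∂_i, ∂_j)` of the coordinate vector fields of the chart `φ`,
at the point with coordinates `y`. -/
def gramMatrix (g : SmoothMetric d M) (φ : OpenPartialHomeomorph M (EuclideanSpace ℝ (Fin d)))
    (y : EuclideanSpace ℝ (Fin d)) : Matrix (Fin d) (Fin d) ℝ :=
  Matrix.of fun i j =>
    g.inner (φ.symm y)
      (mfderiv (𝓡 d) (𝓡 d) φ.symm y (EuclideanSpace.single i (1 : ℝ)))
      (mfderiv (𝓡 d) (𝓡 d) φ.symm y (EuclideanSpace.single j (1 : ℝ)))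

/-- The measure `√(det g_ij) dy¹ ⋯ dyᵈ` on the domain of the chart `φ`, as a measure on `M`
that gives no mass to the complement of this domain. -/
def chartVolume [MeasurableSpace M] (g : SmoothMetric d M)
    (φ : OpenPartialHomeomorph M (EuclideanSpace ℝ (Fin d))) : Measure M :=
  ((volume.restrict φ.target).withDensity
    fun y => ENNReal.ofReal (Real.sqrt (gramMatrix g φ y).det)).map φ.symm

/-- The Riemannian volume measure `dV^g`: the chart measures `√(det g_ij) dy` agree on overlaps,
and `dV^g` is the measure they glue to, which is their supremum (over all smooth charts). -/
def riemannianVolume [MeasurableSpace M] (g : SmoothMetric d M) : Measure M :=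
  ⨆ φ : IsManifold.maximalAtlas (𝓡 d) ∞ M, chartVolume g φ.1

/-- `g' = Ω² g` with `Ω` a smooth positive function. -/
def IsRescaling (g g' : SmoothMetric d M) (Ω : M → ℝ) : Prop :=
  ContMDiff (𝓡 d) 𝓘(ℝ, ℝ) ∞ Ω ∧ (∀ x, 0 < Ω x) ∧
    ∀ (x : M) (v w : TangentSpace (𝓡 d) x), g'.inner x v w = Ω x ^ 2 * g.inner x v w

end Volume

/-- A conformal class of metrics `c = [g] = [Ω² g]`. -/
structure ConformalStructure (d : ℕ) (M : Type*) [TopologicalSpace M]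
    [ChartedSpace (EuclideanSpace ℝ (Fin d)) M] [IsManifold (𝓡 d) ∞ M] where
  metrics : Set (SmoothMetric d M)
  exists_eq : ∃ g : SmoothMetric d M, metrics = {g' | ∃ Ω : M → ℝ, IsRescaling g g' Ω}

/-- A conformal density `[g ; f] = [Ω² g ; Ω^w f]` of weight `w`: a smooth function `rep g` for each
metric `g` of the conformal class, with the corresponding transformation law. -/
structure ConformalDensity {d : ℕ} {M : Type*} [TopologicalSpace M]
    [ChartedSpace (EuclideanSpace ℝ (Fin d)) M] [IsManifold (𝓡 d) ∞ M]
    (c : ConformalStructure d M) (w : ℝ) where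
  rep : c.metrics → M → ℝ
  smooth : ∀ g, ContMDiff (𝓡 d) 𝓘(ℝ, ℝ) ∞ (rep g)
  rescale : ∀ (g g' : c.metrics) (Ω : M → ℝ), IsRescaling g.1 g'.1 Ω →
    ∀ x, rep g' x = Ω x ^ w * rep g x

namespace ConformalDensity

variable {d : ℕ} {M : Type*} [TopologicalSpace M]
  [ChartedSpace (EuclideanSpace ℝ (Fin d)) M] [IsManifold (𝓡 d) ∞ M]
  {c : ConformalStructure d M}

/-- The unit density `1 = [g ; 1]`, of weight zero. -/
def unit (c : ConformalStructure d M) : ConformalDensity c 0 where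
  rep := fun _ _ => 1
  smooth := fun _ => contMDiff_const
  rescale := fun _ _ _ _ _ => by simp

/-- A true scale: a strictly positive density of weight one. -/
def IsTrueScale (τ : ConformalDensity c 1) : Prop :=
  ∀ g x, 0 < τ.rep g x

/-- The density `1 / τ^k = [g ; τ^(-k)]` of weight `-k`, for a true scale `τ`. -/
def invPow (τ : ConformalDensity c 1) (hτ : τ.IsTrueScale) (k : ℕ) :
    ConformalDensity c (-(k : ℝ)) where
  rep := fun g x => 1 / τ.rep g x ^ k
  smooth := fun g => by
    have h : ContMDiff (𝓡 d) 𝓘(ℝ, ℝ) ∞ (fun x => (τ.rep g x ^ k)⁻¹) :=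
      ((τ.smooth g).pow k).inv₀ (fun x => (pow_pos (hτ g x) k).ne')
    simpa only [one_div] using h
  rescale := fun g g' Ω h x => by
    rw [τ.rescale g g' Ω h x, Real.rpow_one, Real.rpow_neg (h.2.1 x).le, Real.rpow_natCast,
      mul_pow, one_div, one_div, mul_inv]

/-- `σ` is a defining density for `S`: the zero locus of `σ` is `S`, and `dσ ≠ 0` along `S`. -/
def IsDefiningDensity (σ : ConformalDensity c 1) (S : Set M) : Prop :=
  ∀ g : c.metrics, (∀ x, σ.rep g x = 0 ↔ x ∈ S) ∧
    ∀ x ∈ S, mfderiv (𝓡 d) 𝓘(ℝ, ℝ) (σ.rep g) x ≠ 0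

end ConformalDensity

/-- The Heaviside function, with support `ℝ_{≥0}`. -/
def heaviside (x : ℝ) : ℝ := open Classical in if 0 ≤ x then 1 else 0

/-- The delta sequence `ρ_η(t) = η⁻¹ ρ(t / η)`. -/
def mollifier (ρ : ℝ → ℝ) (η : ℝ) (t : ℝ) : ℝ := η⁻¹ * ρ (η⁻¹ * t)

section Integrals

variable {d : ℕ} {M : Type*} [TopologicalSpace M]
  [ChartedSpace (EuclideanSpace ℝ (Fin d)) M] [IsManifold (𝓡 d) ∞ M]
  [MeasurableSpace M] {c : ConformalStructure d M}

/-- The integrand `θ(σ/τ - ε) / σᵈ` of the regulated volume, in the metric `g`. -/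
def regulatedIntegrand (σ τ : ConformalDensity c 1) (g : c.metrics) (ε : ℝ) (x : M) : ℝ :=
  heaviside (σ.rep g x / τ.rep g x - ε) / σ.rep g x ^ d

/-- The regulated volume `∫_D dV^g θ(σ/τ - ε) / σᵈ`, computed in the metric `g`. -/
def regulatedVolume (σ τ : ConformalDensity c 1) (D : Set M) (g : c.metrics) (ε : ℝ) : ℝ :=
  ∫ x in D, regulatedIntegrand σ τ g ε x ∂(riemannianVolume g.1)

/-- `L` is the integral over `D` of the distribution-valued density `f δ^(j)(σ)`:
in each metric of the conformal class, `∫_D dV^g f ρ_η^(j)(σ)` tends to `L` as `η → 0⁺`, for every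
delta sequence `ρ_η` obtained by scaling from a test function `ρ` of integral one. -/
def HasDeltaIntegral {w : ℝ} (σ : ConformalDensity c 1) (j : ℕ) (f : ConformalDensity c w)
    (D : Set M) (L : ℝ) : Prop :=
  ∀ (g : c.metrics) (ρ : ℝ → ℝ), ContDiff ℝ ∞ ρ → HasCompactSupport ρ → ∫ t, ρ t = 1 →
    Tendsto (fun η : ℝ => ∫ x in D,
        f.rep g x * iteratedDeriv j (mollifier ρ η) (σ.rep g x) ∂(riemannianVolume g.1))
      (𝓝[>] 0) (𝓝 L)

end Integrals

/-- `D` has a two-sided collar along `S`: near each of its points on `S` there is a smooth chart in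
which `S` is the coordinate hyperplane `y_i = 0` and in which `D` is a product with the
`y_i`-direction, i.e. membership in `D` does not depend on `y_i`. (Nothing is required of the set
of values of the other coordinates: `D ∩ S` may be all of `S`, or have a boundary or corners.) -/
def IsCollaredAlong (d : ℕ) {M : Type*} [TopologicalSpace M]
    [ChartedSpace (EuclideanSpace ℝ (Fin d)) M] [IsManifold (𝓡 d) ∞ M]
    (D S : Set M) : Prop :=
  ∀ p ∈ D ∩ S, ∃ φ ∈ IsManifold.maximalAtlas (𝓡 d) ∞ M, ∃ i : Fin d, p ∈ φ.source ∧
    (∀ x ∈ φ.source, x ∈ S ↔ φ x i = 0) ∧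
    ∀ x ∈ φ.source, ∀ y ∈ φ.source, (∀ j, j ≠ i → φ x j = φ y j) → (x ∈ D ↔ y ∈ D)

end

/-! Fix a reference metric `g₀` of the class and put u = σ/τ. This function does not depend on the
metric, vanishes exactly on S, and has nonzero differential there. Since dV^g scales by Ω^d, the
regulated volume in any metric equals the `g₀`-integral over D of τ^(-d) θ(u-ε)/u^d, so only the
push-forward of τ^(-d) dV|_D under u matters.

Near zero this push-forward has a smooth density h (`HasTransverseDensity.of_isCollaredAlong`). Near
a point of S the i-th coordinate of the collar chart can be replaced by u, keeping the others
(`exists_straightened_chart`). D is then still a product along u, and h is a fibre integral of a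
smooth weight over a set that does not move with u (`exists_weight_setIntegral`). Away from S
nothing contributes near u = 0, and a partition of unity glues the pieces. Hence Vol_ε = C + ∫_ε^∞
h(t) t^(-d) dt for small ε, and Taylor's formula for h gives the powers, the logarithm and a smooth
remainder (`exists_expansion_integral_div_pow`).

The coefficients are derivatives of h at 0, and these are delta integrals. For every smooth κ > 0,
κ^(j+1) δ^(j)(κu) pairs to (-1)^j h^(j)(0), whatever κ is
(`tendsto_integral_iteratedDeriv_mollifier`). With κ = Ωτ the argument κu is σ in the metric Ω²g₀,
and the powers of Ω and τ combine into the density 1/τ^k and the volume factor, which gives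
independence of the metric. For k = 0 the integrand does not contain τ, so uniqueness of limits
makes the logarithmic coefficient the same for all scales. -/

noncomputable section

/-! ### Smooth dependence of integrals on a parameter -/

section ParametricIntegrals

variable {Z : Type*} [NormedAddCommGroup Z] [NormedSpace ℝ Z]

/-- The partial derivative in the first, real, variable. -/
def partialFst (G : ℝ × Z → ℝ) (p : ℝ × Z) : ℝ := fderiv ℝ G p (1, 0)

theorem contDiff_partialFst {G : ℝ × Z → ℝ} (hG : ContDiff ℝ ∞ G) :
    ContDiff ℝ ∞ (partialFst G) :=
  (hG.fderiv_right (m := ∞) (by simp)).clm_apply contDiff_const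

theorem ContDiff.hasDerivAt_partialFst {G : ℝ × Z → ℝ} (hG : ContDiff ℝ ∞ G) (t : ℝ) (z : Z) :
    HasDerivAt (fun t => G (t, z)) (partialFst G (t, z)) t := by
  have h1 : HasFDerivAt G (fderiv ℝ G (t, z)) (t, z) :=
    (hG.differentiable (by simp) _).hasFDerivAt
  have h2 : HasDerivAt (fun t : ℝ => (t, z)) ((1 : ℝ), (0 : Z)) t :=
    (hasDerivAt_id t).prodMk (hasDerivAt_const t z)
  exact h1.comp_hasDerivAt t h2

variable [MeasurableSpace Z] [BorelSpace Z] {μ : Measure Z} [IsFiniteMeasureOnCompacts μ]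

theorem hasDerivAt_setIntegral_of_contDiff {K : Set Z} (hK : IsCompact K) {G : ℝ × Z → ℝ}
    (hG : ContDiff ℝ ∞ G) (t : ℝ) :
    HasDerivAt (fun t => ∫ z in K, G (t, z) ∂μ) (∫ z in K, partialFst G (t, z) ∂μ) t := by
  have hint : ∀ {H : ℝ × Z → ℝ}, ContDiff ℝ ∞ H → ∀ s, IntegrableOn (fun z => H (s, z)) K μ :=
    fun hH s => (hH.continuous.comp (Continuous.prodMk_right s)).continuousOn.integrableOn_compact hK
  -- Compactness of the unit parameter interval times K yields a constant dominating function.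
  obtain ⟨C, hC⟩ := ((isCompact_closedBall t 1).prod hK).exists_bound_of_continuousOn
    (contDiff_partialFst hG).continuous.continuousOn
  refine (hasDerivAt_integral_of_dominated_loc_of_deriv_le (μ := μ.restrict K)
    (F := fun s z => G (s, z)) (F' := fun s z => partialFst G (s, z)) (bound := fun _ => C)
    (Metric.ball_mem_nhds t one_pos) ?_ (hint hG t)
    (hint (contDiff_partialFst hG) t).aestronglyMeasurable ?_ ?_ ?_).2
  · exact Eventually.of_forall fun s => (hint hG s).aestronglyMeasurable
  · filter_upwards [ae_restrict_mem hK.measurableSet] with z hz s hs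
    exact hC (s, z) ⟨Metric.ball_subset_closedBall hs, hz⟩
  · exact integrableOn_const hK.measure_lt_top.ne
  · exact Eventually.of_forall fun z s _ => hG.hasDerivAt_partialFst s z

theorem deriv_setIntegral_of_contDiff {K : Set Z} (hK : IsCompact K) {G : ℝ × Z → ℝ}
    (hG : ContDiff ℝ ∞ G) :
    deriv (fun t => ∫ z in K, G (t, z) ∂μ) = fun t => ∫ z in K, partialFst G (t, z) ∂μ :=
  funext fun t => (hasDerivAt_setIntegral_of_contDiff hK hG t).deriv

theorem contDiff_setIntegral_of_contDiff {K : Set Z} (hK : IsCompact K) {G : ℝ × Z → ℝ}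
    (hG : ContDiff ℝ ∞ G) : ContDiff ℝ ∞ (fun t => ∫ z in K, G (t, z) ∂μ) := by
  refine contDiff_infty.2 fun n => ?_
  induction n generalizing G with
  | zero =>
    exact contDiff_zero.2 (continuous_iff_continuousAt.2 fun t =>
      (hasDerivAt_setIntegral_of_contDiff hK hG t).continuousAt)
  | succ n ih =>
    rw [show ((n + 1 : ℕ) : WithTop ℕ∞) = (n : WithTop ℕ∞) + 1 by norm_cast,
      contDiff_succ_iff_deriv]
    refine ⟨fun t => (hasDerivAt_setIntegral_of_contDiff hK hG t).differentiableAt, by simp, ?_⟩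
    rw [deriv_setIntegral_of_contDiff hK hG]
    exact ih (contDiff_partialFst hG)

end ParametricIntegrals

/-! ### Taylor expansion and the model integral on the half-line -/

/-- Taylor's formula with a smooth quotient remainder. -/
theorem ContDiff.exists_taylor_quotient (n : ℕ) {h : ℝ → ℝ} (hh : ContDiff ℝ ∞ h) :
    ∃ r : ℝ → ℝ, ContDiff ℝ ∞ r ∧ r 0 = iteratedDeriv n h 0 / n.factorial ∧
      ∀ t, h t = (∑ m ∈ Finset.range n, iteratedDeriv m h 0 / m.factorial * t ^ m) +
        t ^ n * r t := by
  induction n generalizing h with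
  | zero => exact ⟨h, hh, by simp, fun t => by simp⟩
  | succ n ih =>
    have hd : ContDiff ℝ ∞ (deriv h) := (contDiff_infty_iff_deriv.1 hh).2
    obtain ⟨r, hr, hr0, hrt⟩ := ih hd
    have hG : ContDiff ℝ ∞ (fun p : ℝ × ℝ => p.2 ^ n * r (p.1 * p.2)) :=
      (contDiff_snd.pow n).mul (hr.comp (contDiff_fst.mul contDiff_snd))
    -- Insert the expansion of h' into h(t) - h(0) = t ∫₀¹ h'(ts) ds: the remainder r of h' produces
    -- this remainder, smooth as a parametric integral.
    refine ⟨fun t => ∫ s in Icc (0 : ℝ) 1, s ^ n * r (t * s),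
      contDiff_setIntegral_of_contDiff isCompact_Icc hG, ?_, fun t => ?_⟩
    · beta_reduce
      rw [integral_Icc_eq_integral_Ioc, ← intervalIntegral.integral_of_le zero_le_one]
      simp only [zero_mul, intervalIntegral.integral_mul_const, integral_pow]
      rw [hr0, iteratedDeriv_succ', Nat.factorial_succ]
      push_cast
      field_simp
      simp
    · have h1 : h t - h 0 = ∫ s in (0 : ℝ)..1, t * deriv h (t * s) := by
        have hder : ∀ s ∈ uIcc (0 : ℝ) 1,
            HasDerivAt (fun s => h (t * s)) (t * deriv h (t * s)) s := fun s _ => by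
          have := ((hh.differentiable (by simp) (t * s)).hasDerivAt).comp s
            ((hasDerivAt_id s).const_mul t)
          simpa [mul_comm, Function.comp_def] using this
        rw [intervalIntegral.integral_eq_sub_of_hasDerivAt hder
          (Continuous.intervalIntegrable (continuous_const.mul (hd.continuous.comp
            (continuous_const.mul continuous_id))) _ _)]
        simp
      have h2 : ∫ s in (0 : ℝ)..1, t * deriv h (t * s) =
          (∑ m ∈ Finset.range n, iteratedDeriv m (deriv h) 0 / m.factorial * t ^ (m + 1) *
            (1 / (m + 1))) + t ^ (n + 1) * ∫ s in (0 : ℝ)..1, s ^ n * r (t * s) := by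
        have : ∀ s, t * deriv h (t * s) =
            (∑ m ∈ Finset.range n, iteratedDeriv m (deriv h) 0 / m.factorial * t ^ (m + 1) *
              s ^ m) + t ^ (n + 1) * (s ^ n * r (t * s)) := fun s => by
          rw [hrt, mul_add, Finset.mul_sum]
          congr 1
          · exact Finset.sum_congr rfl fun m _ => by ring
          · ring
        simp_rw [this]
        have hrc : Continuous fun s => r (t * s) :=
          hr.continuous.comp (continuous_const.mul continuous_id)
        rw [intervalIntegral.integral_add, intervalIntegral.integral_finsetSum]
        · congr 1
          · refine Finset.sum_congr rfl fun m _ => ?_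
            rw [intervalIntegral.integral_const_mul, integral_pow]
            simp
          · rw [intervalIntegral.integral_const_mul]
        · exact fun m _ => Continuous.intervalIntegrable (by fun_prop) _ _
        · exact Continuous.intervalIntegrable (by fun_prop) _ _
        · exact Continuous.intervalIntegrable (by fun_prop) _ _
      beta_reduce
      rw [Finset.sum_range_succ', integral_Icc_eq_integral_Ioc,
        ← intervalIntegral.integral_of_le zero_le_one]
      have h3 : h t = (h t - h 0) + h 0 := by ring
      rw [h3, h1, h2]
      simp only [pow_zero, Nat.factorial_zero, iteratedDeriv_zero, Nat.cast_one, div_one, mul_one]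
      rw [add_right_comm]
      congr 2
      refine Finset.sum_congr rfl fun m _ => ?_
      rw [iteratedDeriv_succ', Nat.factorial_succ]
      push_cast
      field_simp

/-- A smooth function whose derivatives of order less than `j` vanish at the origin. -/
theorem ContDiff.tendsto_inv_pow_mul {h : ℝ → ℝ} (hh : ContDiff ℝ ∞ h) (j : ℕ)
    (h0 : ∀ m < j, iteratedDeriv m h 0 = 0) :
    Tendsto (fun η : ℝ => (η ^ j)⁻¹ * h η) (𝓝[>] 0) (𝓝 (iteratedDeriv j h 0 / j.factorial)) := by
  obtain ⟨r, hr, hr0, hrt⟩ := hh.exists_taylor_quotient j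
  rw [← hr0]
  refine ((hr.continuous.tendsto 0).mono_left nhdsWithin_le_nhds).congr' ?_
  filter_upwards [self_mem_nhdsWithin] with η hη
  have : ∑ m ∈ Finset.range j, iteratedDeriv m h 0 / m.factorial * η ^ m = 0 :=
    Finset.sum_eq_zero fun m hm => by simp [h0 m (Finset.mem_range.1 hm)]
  have hη : η ^ j ≠ 0 := pow_ne_zero _ (ne_of_gt hη)
  rw [hrt η, this, zero_add, inv_mul_cancel_left₀ hη]

/-- The asymptotic expansion of `∫_ε^∞ h(t) t^(-d) dt`. -/
theorem exists_expansion_integral_div_pow {d : ℕ} (hd : 1 ≤ d) {h : ℝ → ℝ} (hh : ContDiff ℝ ∞ h)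
    (hc : HasCompactSupport h) :
    ∃ (C : ℝ) (R : ℝ → ℝ), ContDiff ℝ ∞ R ∧ ∀ ε : ℝ, 0 < ε → ε < 1 →
      ∫ t in Ioi ε, h t / t ^ d =
        (∑ k ∈ Finset.Icc 1 (d - 1),
          iteratedDeriv (d - 1 - k) h 0 / ((d - 1 - k).factorial * (k : ℝ)) * (ε ^ k)⁻¹) -
        iteratedDeriv (d - 1) h 0 / (d - 1).factorial * Real.log ε + C + ε * R ε := by
  obtain ⟨r, hr, -, hrt⟩ := hh.exists_taylor_quotient d
  obtain ⟨B, hB1, hB⟩ : ∃ B : ℝ, 1 < B ∧ ∀ t, B ≤ t → h t = 0 := by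
    obtain ⟨B, hB⟩ := hc.isCompact.isBounded.subset_closedBall (0 : ℝ)
    refine ⟨max B 1 + 1, by linarith [le_max_right B 1], fun t ht => ?_⟩
    by_contra hne
    have := hB (subset_tsupport _ hne)
    rw [Metric.mem_closedBall, dist_zero_right, Real.norm_eq_abs] at this
    linarith [le_abs_self t, le_max_left B 1]
  set c : ℕ → ℝ := fun m => iteratedDeriv m h 0 / m.factorial with hcdef
  have hG : ContDiff ℝ ∞ (fun p : ℝ × ℝ => r (p.1 * p.2)) := by fun_prop
  obtain ⟨e, rfl⟩ : ∃ e, d = e + 1 := ⟨d - 1, by omega⟩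
  -- The constant collects the endpoint terms at B, a bound beyond which h vanishes, and ∫₀ᴮ r. The
  -- remainder comes from ∫₀^ε r = ε ∫₀¹ r(εs) ds.
  refine ⟨-(∑ k ∈ Finset.Icc 1 e, c (e - k) * ((k : ℝ)⁻¹ * (B ^ k)⁻¹)) + c e * Real.log B +
      ∫ t in (0 : ℝ)..B, r t, fun t => -∫ s in Icc (0 : ℝ) 1, r (t * s),
    (contDiff_setIntegral_of_contDiff isCompact_Icc hG).neg, fun ε hε hε1 => ?_⟩
  have hεB : ε ≤ B := by linarith
  have hpos : ∀ t ∈ uIcc ε B, 0 < t := fun t ht => by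
    rw [uIcc_of_le hεB] at ht; linarith [ht.1]
  have hrc : Continuous r := hr.continuous
  have h1 : ∫ t in Ioi ε, h t / t ^ (e + 1) = ∫ t in ε..B, h t / t ^ (e + 1) := by
    rw [intervalIntegral.integral_of_le hεB]
    refine setIntegral_eq_of_subset_of_forall_sdiff_eq_zero measurableSet_Ioi
      (fun t ht => ht.1) fun t ht => ?_
    have : B ≤ t := by
      by_contra hlt
      exact ht.2 ⟨ht.1, (not_le.1 hlt).le⟩
    simp [hB t this]
  have h2 : ∫ t in ε..B, h t / t ^ (e + 1) =
      (∑ m ∈ Finset.range (e + 1), c m * ∫ t in ε..B, t ^ ((m : ℤ) - (e + 1))) +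
        ∫ t in ε..B, r t := by
    have hcz : ∀ m : ℕ, IntervalIntegrable (fun t : ℝ => t ^ ((m : ℤ) - (e + 1))) volume ε B :=
      fun m => ContinuousOn.intervalIntegrable fun t ht =>
        (continuousAt_zpow₀ t _ (Or.inl (hpos t ht).ne')).continuousWithinAt
    rw [show (∑ m ∈ Finset.range (e + 1), c m * ∫ t in ε..B, t ^ ((m : ℤ) - (e + 1))) =
      ∫ t in ε..B, ∑ m ∈ Finset.range (e + 1), c m * t ^ ((m : ℤ) - (e + 1)) by
        rw [intervalIntegral.integral_finsetSum fun m _ => (hcz m).const_mul _]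
        simp_rw [intervalIntegral.integral_const_mul], ← intervalIntegral.integral_add]
    · refine intervalIntegral.integral_congr fun t ht => ?_
      have htp := hpos t ht
      rw [hrt t, add_div, Finset.sum_div, mul_div_cancel_left₀ _ (pow_ne_zero _ htp.ne')]
      congr 1
      refine Finset.sum_congr rfl fun m _ => ?_
      rw [zpow_sub₀ htp.ne', mul_div_assoc]
      norm_cast
    · have := IntervalIntegrable.sum (Finset.range (e + 1)) (μ := volume) (a := ε) (b := B)
        (f := fun m => fun t : ℝ => c m * t ^ ((m : ℤ) - (e + 1)))
        fun m _ => (hcz m).const_mul (c m)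
      simpa only [Finset.sum_fn] using this
    · exact hrc.intervalIntegrable _ _
  -- With k = e - m the exponent is -k-1; only m = e, exponent -1, yields the logarithm.
  have h3 : (∑ m ∈ Finset.range (e + 1), c m * ∫ t in ε..B, t ^ ((m : ℤ) - (e + 1))) =
      (∑ k ∈ Finset.Icc 1 e, c (e - k) * ((k : ℝ)⁻¹ * ((ε ^ k)⁻¹ - (B ^ k)⁻¹))) +
        c e * (Real.log B - Real.log ε) := by
    rw [Finset.sum_range_succ]
    congr 1
    · refine Finset.sum_bij' (fun m _ => e - m) (fun k _ => e - k) ?_ ?_ ?_ ?_ ?_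
      · intro m hm; simp at hm ⊢; omega
      · intro m hm; simp at hm ⊢; omega
      · intro m hm; simp at hm ⊢; omega
      · intro m hm; simp at hm ⊢; omega
      · intro m hm
        rw [Finset.mem_range] at hm
        obtain ⟨k, rfl⟩ : ∃ k, e = m + k := ⟨e - m, by omega⟩
        have hk : 0 < k := by omega
        rw [integral_zpow (Or.inr ⟨by push_cast; omega, fun h0 => (hpos 0 h0).ne' rfl⟩)]
        rw [show m + k - m = k by omega, show m + k - k = m by omega]
        rw [show ((m : ℤ) - (((m + k : ℕ) : ℤ) + 1) + 1) = -(k : ℤ) by push_cast; ring]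
        rw [zpow_neg, zpow_neg, zpow_natCast, zpow_natCast]
        have hk' : (k : ℝ) ≠ 0 := by positivity
        have : ((((m : ℤ) - (((m + k : ℕ) : ℤ) + 1) : ℤ) : ℝ) + 1) = -(k : ℝ) := by
          push_cast; ring
        rw [this]
        field_simp
        ring
    · congr 1
      rw [show ((e : ℤ) - (e + 1)) = -1 by ring]
      simp_rw [zpow_neg_one]
      rw [integral_inv_of_pos hε (by linarith), Real.log_div (by linarith) hε.ne']
  have h4 : ∫ t in ε..B, r t = (∫ t in (0 : ℝ)..B, r t) - ε * ∫ s in Icc (0 : ℝ) 1, r (ε * s) := by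
    rw [integral_Icc_eq_integral_Ioc, ← intervalIntegral.integral_of_le zero_le_one,
      intervalIntegral.mul_integral_comp_mul_left, mul_zero, mul_one,
      intervalIntegral.integral_interval_sub_left (hrc.intervalIntegrable _ _)
        (hrc.intervalIntegrable _ _)]
  rw [h1, h2, h3, h4, Nat.add_sub_cancel]
  have h5 : ∀ k ∈ Finset.Icc 1 e, iteratedDeriv (e - k) h 0 / ((e - k).factorial * (k : ℝ)) *
      (ε ^ k)⁻¹ = c (e - k) * ((k : ℝ)⁻¹ * (ε ^ k)⁻¹) := fun k _ => by
    simp only [hcdef]; rw [div_mul_eq_div_div]; ring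
  rw [Finset.sum_congr rfl h5]
  simp_rw [mul_sub]
  rw [Finset.sum_sub_distrib]
  simp only [hcdef]
  ring

/-! ### Moments and scaling of derivatives of test functions -/

theorem HasCompactSupport.iteratedDeriv' {ρ : ℝ → ℝ} (hc : HasCompactSupport ρ) (j : ℕ) :
    HasCompactSupport (iteratedDeriv j ρ) := by
  induction j with
  | zero => simpa using hc
  | succ j ih => rw [iteratedDeriv_succ]; exact ih.deriv

theorem ContDiff.iteratedDeriv_infty {ρ : ℝ → ℝ} (hρ : ContDiff ℝ ∞ ρ) (j : ℕ) :
    ContDiff ℝ ∞ (iteratedDeriv j ρ) := by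
  induction j with
  | zero => simpa using hρ
  | succ j ih => rw [iteratedDeriv_succ]; exact (contDiff_infty_iff_deriv.1 ih).2

/-- The moments of order at most `j` of the `j`-th derivative of a test function. -/
theorem integral_pow_mul_iteratedDeriv {ρ : ℝ → ℝ} (hρ : ContDiff ℝ ∞ ρ)
    (hc : HasCompactSupport ρ) {m j : ℕ} (hmj : m ≤ j) :
    ∫ r, r ^ m * iteratedDeriv j ρ r =
      if m = j then (-1) ^ j * j.factorial * ∫ r, ρ r else 0 := by
  induction j generalizing m with
  | zero =>
    obtain rfl : m = 0 := by omega
    simp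
  | succ j ih =>
    have hs := hρ.iteratedDeriv_infty j
    have hcs := hc.iteratedDeriv' j
    have hs' := (contDiff_infty_iff_deriv.1 hs).2
    -- Integration by parts lowers the power and the order of the derivative together; for m = 0 the
    -- factor m kills the integral.
    have key : ∫ r, r ^ m * iteratedDeriv (j + 1) ρ r =
        -∫ r, ((m : ℝ) * r ^ (m - 1)) * iteratedDeriv j ρ r := by
      rw [iteratedDeriv_succ]
      refine integral_mul_deriv_eq_deriv_mul_of_integrable
        (fun r _ => hasDerivAt_pow m r) (fun r _ => (hs.differentiable (by simp) r).hasDerivAt) ?_ ?_ ?_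
      · exact Continuous.integrable_of_hasCompactSupport
          ((continuous_pow m).mul hs'.continuous) (hcs.deriv.mul_left)
      · exact Continuous.integrable_of_hasCompactSupport
          ((continuous_const.mul (continuous_pow _)).mul hs.continuous) (hcs.mul_left)
      · exact Continuous.integrable_of_hasCompactSupport
          ((continuous_pow m).mul hs.continuous) (hcs.mul_left)
    rw [key]
    simp_rw [mul_assoc]
    rw [integral_const_mul]
    cases m with
    | zero => simp
    | succ m =>
      rw [Nat.add_sub_cancel, ih (by omega)]
      by_cases h : m = j
      · subst h
        simp only [if_true, Nat.factorial_succ]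
        push_cast
        ring
      · simp [h]

theorem iteratedDeriv_mollifier {ρ : ℝ → ℝ} (hρ : ContDiff ℝ ∞ ρ) (j : ℕ) (η t : ℝ) :
    iteratedDeriv j (mollifier ρ η) t = η⁻¹ ^ (j + 1) * iteratedDeriv j ρ (η⁻¹ * t) := by
  have h1 : iteratedDeriv j (mollifier ρ η) = fun t => η⁻¹ * (η⁻¹ ^ j * iteratedDeriv j ρ (η⁻¹ * t)) := by
    funext t
    have := iteratedDeriv_comp_const_mul (n := j) (hρ.of_le (by exact_mod_cast le_top)) η⁻¹
    have h2 := iteratedDeriv_const_mul_field (n := j) (x := t) η⁻¹ (fun t => ρ (η⁻¹ * t))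
    rw [this] at h2
    exact h2
  rw [h1, pow_succ]; ring

/-! ### Derivatives of the delta function on a product -/

section Local

variable {E : Type*} [NormedAddCommGroup E] [NormedSpace ℝ E]

theorem partialFst_comp_mul {F : ℝ × E × ℝ → ℝ} (hF : ContDiff ℝ ∞ F) (p : ℝ × E × ℝ) :
    partialFst (fun q : ℝ × E × ℝ => F (q.1 * q.2.2, q.2)) p =
      p.2.2 * partialFst F (p.1 * p.2.2, p.2) := by
  have hG : ContDiff ℝ ∞ (fun q : ℝ × E × ℝ => F (q.1 * q.2.2, q.2)) := by fun_prop
  have h1 := hG.hasDerivAt_partialFst p.1 p.2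
  have h2 := (hF.hasDerivAt_partialFst (p.1 * p.2.2) p.2).comp p.1
    ((hasDerivAt_id p.1).mul_const p.2.2)
  rw [h1.unique h2, one_mul, mul_comm]

theorem partialFst_pow_mul {F : ℝ × E × ℝ → ℝ} (hF : ContDiff ℝ ∞ F) (m : ℕ) (p : ℝ × E × ℝ) :
    partialFst (fun q : ℝ × E × ℝ => q.2.2 ^ m * F q) p = p.2.2 ^ m * partialFst F p := by
  have hG : ContDiff ℝ ∞ (fun q : ℝ × E × ℝ => q.2.2 ^ m * F q) := by fun_prop
  exact (hG.hasDerivAt_partialFst p.1 p.2).unique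
    ((hF.hasDerivAt_partialFst p.1 p.2).const_mul (p.2.2 ^ m))

variable [MeasurableSpace E] [BorelSpace E] {μ : Measure E}
  [IsFiniteMeasureOnCompacts μ]

/-- By the chain rule each η-derivative produces one factor r (the last coordinate), which commutes
with differentiation in the first slot; at η = 0 the first slot is 0. This turns Taylor coefficients
in η into r-moments at frozen s. -/
theorem iteratedDeriv_setIntegral_comp_mul {K : Set (E × ℝ)} (hK : IsCompact K) (m : ℕ)
    {F : ℝ × E × ℝ → ℝ} (hF : ContDiff ℝ ∞ F) :
    iteratedDeriv m (fun η => ∫ z in K, F (η * z.2, z) ∂(μ.prod volume)) 0 =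
      iteratedDeriv m (fun s => ∫ z in K, z.2 ^ m * F (s, z) ∂(μ.prod volume)) 0 := by
  induction m generalizing F with
  | zero => simp
  | succ m ih =>
    have hF' := contDiff_partialFst hF
    have hG : ContDiff ℝ ∞ (fun q : ℝ × E × ℝ => F (q.1 * q.2.2, q.2)) := by fun_prop
    have hP : ContDiff ℝ ∞ (fun q : ℝ × E × ℝ => q.2.2 ^ (m + 1) * F q) := by fun_prop
    have hL : ContDiff ℝ ∞ (fun q : ℝ × E × ℝ => q.2.2 * partialFst F q) := by fun_prop
    rw [iteratedDeriv_succ', iteratedDeriv_succ', deriv_setIntegral_of_contDiff hK hG,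
      deriv_setIntegral_of_contDiff hK hP]
    simp_rw [partialFst_comp_mul hF, partialFst_pow_mul hF]
    rw [ih hL]
    simp_rw [pow_succ, mul_assoc]

/-- The integral of `δ^(j)(κ t)`, weighted with `κ^(j+1)`, over a product along the `t`-direction. -/
theorem tendsto_integral_iteratedDeriv_mollifier [SecondCountableTopology E] [SFinite μ]
    {W κ : ℝ × E → ℝ} (hW : ContDiff ℝ ∞ W) (hWc : HasCompactSupport W) {B : Set E} (hB : IsCompact B) {O : Set (ℝ × E)} (hO : IsOpen O)
    (hWO : tsupport W ⊆ O) (hκ : ContDiffOn ℝ ∞ κ O) (hκ0 : ∀ p ∈ O, 0 < κ p)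
    {ρ : ℝ → ℝ} (hρ : ContDiff ℝ ∞ ρ) (hρc : HasCompactSupport ρ) (hρ1 : ∫ t, ρ t = 1) (j : ℕ) :
    Tendsto (fun η : ℝ => ∫ y in B, ∫ t, W (t, y) * κ (t, y) ^ (j + 1) *
        iteratedDeriv j (mollifier ρ η) (κ (t, y) * t) ∂volume ∂μ) (𝓝[>] 0)
      (𝓝 ((-1) ^ j * iteratedDeriv j (fun t => ∫ y in B, W (t, y) ∂μ) 0)) := by
  -- After t = ηr the integrand becomes η^(-j) F(ηr, y, r), with F smooth and independent of η.
  -- Smoothness of κ is only needed near the support of W.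
  set F : ℝ × E × ℝ → ℝ := fun p => W (p.1, p.2.1) * κ (p.1, p.2.1) ^ (j + 1) *
    iteratedDeriv j ρ (κ (p.1, p.2.1) * p.2.2) with hFdef
  have hρj := hρ.iteratedDeriv_infty j
  have hF : ContDiff ℝ ∞ F := by
    rw [contDiff_iff_contDiffAt]
    intro p
    by_cases hp : (p.1, p.2.1) ∈ tsupport W
    · have h1 : ContDiffAt ℝ ∞ (fun p : ℝ × E × ℝ => (p.1, p.2.1)) p := by fun_prop
      have h2 : ContDiffAt ℝ ∞ (fun p : ℝ × E × ℝ => κ (p.1, p.2.1)) p :=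
        ContDiffAt.comp p (hκ.contDiffAt (hO.mem_nhds (hWO hp))) h1
      have h3 : ContDiffAt ℝ ∞ (fun p : ℝ × E × ℝ => p.2.2) p := by fun_prop
      exact ((hW.contDiffAt.comp p h1).mul (h2.pow _)).mul (hρj.contDiffAt.comp p (h2.mul h3))
    · have hcont : Continuous (fun p : ℝ × E × ℝ => (p.1, p.2.1)) := by fun_prop
      have : ∀ᶠ q in 𝓝 p, F q = 0 := by
        filter_upwards [hcont.continuousAt.preimage_mem_nhds
          ((isClosed_tsupport W).isOpen_compl.mem_nhds hp)] with q hq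
        simp [hFdef, image_eq_zero_of_notMem_tsupport hq]
      exact (contDiffAt_const (c := (0 : ℝ))).congr_of_eventuallyEq this
  obtain ⟨b, hb⟩ : ∃ b : ℝ, ∀ t, b < |t| → iteratedDeriv j ρ t = 0 := by
    obtain ⟨b, hb⟩ := (hρc.iteratedDeriv' j).isCompact.isBounded.subset_closedBall (0 : ℝ)
    refine ⟨b, fun t ht => ?_⟩
    by_contra hne
    have := hb (subset_tsupport _ hne)
    rw [Metric.mem_closedBall, dist_zero_right, Real.norm_eq_abs] at this
    linarith
  obtain ⟨c, hc0, hc⟩ : ∃ c : ℝ, 0 < c ∧ ∀ p ∈ tsupport W, c ≤ κ p := by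
    rcases (tsupport W).eq_empty_or_nonempty with he | hne
    · exact ⟨1, one_pos, by simp [he]⟩
    · obtain ⟨p, hp, hmin⟩ := hWc.isCompact.exists_isMinOn hne (hκ.continuousOn.mono hWO)
      exact ⟨κ p, hκ0 p (hWO hp), fun q hq => hmin hq⟩
  -- Since κ ≥ c on the support of W, |r| > L forces |κr| > b, outside the support of the derivative
  -- of ρ; so r may be confined to a compact interval.
  set L : ℝ := |b| / c + 1
  have hFL : ∀ s y r, r ∉ Icc (-L) L → F (s, y, r) = 0 := by
    intro s y r hr
    by_cases hp : (s, y) ∈ tsupport W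
    · have hL : L < |r| := by
        by_contra hle
        exact hr (abs_le.1 (not_lt.1 hle))
      have hκc := hc _ hp
      have : b < |κ (s, y) * r| := by
        rw [abs_mul, abs_of_pos (hc0.trans_le hκc)]
        have h1 : |b| / c < |r| := by linarith
        rw [div_lt_iff₀ hc0] at h1
        nlinarith [le_abs_self b, abs_nonneg r]
      simp [hFdef, hb _ this]
    · simp [hFdef, image_eq_zero_of_notMem_tsupport hp]
  set K : Set (E × ℝ) := B ×ˢ Icc (-L) L
  have hK : IsCompact K := hB.prod isCompact_Icc
  have hfub : ∀ {H : E × ℝ → ℝ}, Continuous H → (∀ y r, r ∉ Icc (-L) L → H (y, r) = 0) →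
      ∫ z in K, H z ∂(μ.prod volume) = ∫ y in B, ∫ r, H (y, r) ∂volume ∂μ := by
    intro H hH h0
    rw [setIntegral_prod _ (hH.continuousOn.integrableOn_compact hK)]
    congr 1
    funext y
    exact setIntegral_eq_integral_of_forall_compl_eq_zero fun r hr => h0 y r hr
  set J : ℝ → ℝ := fun η => ∫ z in K, F (η * z.2, z) ∂(μ.prod volume) with hJ
  have hJs : ContDiff ℝ ∞ J := by
    have hG : ContDiff ℝ ∞ (fun q : ℝ × E × ℝ => F (q.1 * q.2.2, q.2)) := by fun_prop
    exact contDiff_setIntegral_of_contDiff hK hG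
  -- At frozen s the substitution q = κr leaves κ^(j-m) times the m-th moment of the derivative of
  -- ρ. This vanishes for m < j, and for m = j the powers of κ cancel: here κ drops out of the
  -- limit.
  have hmom : ∀ m ≤ j, (fun s => ∫ z in K, z.2 ^ m * F (s, z) ∂(μ.prod volume)) = fun s =>
      if m = j then (-1) ^ j * j.factorial * ∫ y in B, W (s, y) ∂μ else 0 := by
    intro m hm
    funext s
    rw [hfub (by have := hF.continuous; fun_prop) fun y r hr => by simp [hFL s y r hr]]
    have hinner : ∀ y, ∫ r, r ^ m * F (s, y, r) =
        if m = j then (-1) ^ j * j.factorial * W (s, y) else 0 := by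
      intro y
      by_cases hp : (s, y) ∈ tsupport W
      · have hκp : 0 < κ (s, y) := hκ0 _ (hWO hp)
        set k := κ (s, y) with hk
        have h1 : ∀ r, r ^ m * F (s, y, r) = (W (s, y) * k ^ (j + 1) * k⁻¹ ^ m) *
            ((k * r) ^ m * iteratedDeriv j ρ (k * r)) := by
          intro r
          simp only [hFdef, ← hk]
          rw [mul_pow, inv_pow]
          field_simp
        simp_rw [h1]
        rw [integral_const_mul, Measure.integral_comp_mul_left
          (fun q => q ^ m * iteratedDeriv j ρ q) k, integral_pow_mul_iteratedDeriv hρ hρc hm, hρ1]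
        by_cases hmj : m = j
        · subst hmj
          simp only [if_true, smul_eq_mul, abs_of_pos (inv_pos.2 hκp), inv_pow, pow_succ k]
          field_simp
        · simp [hmj]
      · simp [hFdef, image_eq_zero_of_notMem_tsupport hp]
    simp_rw [hinner]
    by_cases hmj : m = j
    · simp only [hmj, if_true]
      rw [integral_const_mul]
    · simp [hmj]
  have h0 : ∀ m < j, iteratedDeriv m J 0 = 0 := by
    intro m hm
    rw [hJ, iteratedDeriv_setIntegral_comp_mul hK m hF, hmom m hm.le]
    simp [hm.ne]
  have hj : iteratedDeriv j J 0 = (-1) ^ j * j.factorial *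
      iteratedDeriv j (fun t => ∫ y in B, W (t, y) ∂μ) 0 := by
    rw [hJ, iteratedDeriv_setIntegral_comp_mul hK j hF, hmom j le_rfl]
    simp only [if_true]
    rw [iteratedDeriv_const_mul_field]
  -- J vanishes to order j at 0, so η^(-j) J(η) tends to its j-th Taylor coefficient.
  have hlim := hJs.tendsto_inv_pow_mul j h0
  rw [hj, mul_right_comm, mul_div_assoc, div_self (by positivity), mul_one] at hlim
  refine hlim.congr' ?_
  filter_upwards [self_mem_nhdsWithin] with η (hη : 0 < η)
  rw [hJ]
  simp only
  rw [hfub (by have := hF.continuous; fun_prop) fun y r hr => hFL _ y r hr, ← integral_const_mul]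
  congr 1
  funext y
  have hsc := Measure.integral_comp_mul_left (fun t => W (t, y) * κ (t, y) ^ (j + 1) *
        iteratedDeriv j (mollifier ρ η) (κ (t, y) * t)) η
  rw [abs_of_pos (inv_pos.2 hη), smul_eq_mul] at hsc
  have hsc' := congrArg (fun q => η * q) hsc
  simp only [mul_inv_cancel_left₀ hη.ne'] at hsc'
  rw [← hsc', ← integral_const_mul, ← integral_const_mul]
  congr 1
  funext r
  rw [iteratedDeriv_mollifier hρ]
  simp only [hFdef]
  rw [show η⁻¹ * (κ (η * r, y) * (η * r)) = κ (η * r, y) * r by field_simp, inv_pow, pow_succ η]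
  field_simp

end Local

/-! ### The Gram matrix in charts: positivity, smoothness, transformation -/

section GramMatrix

variable {d : ℕ} {M : Type*} [TopologicalSpace M]
  [ChartedSpace (EuclideanSpace ℝ (Fin d)) M]

theorem OpenPartialHomeomorph.mDifferentiable_of_mem_maximalAtlas
    {φ : OpenPartialHomeomorph M (EuclideanSpace ℝ (Fin d))}
    (hφ : φ ∈ IsManifold.maximalAtlas (𝓡 d) ∞ M) : φ.MDifferentiable (𝓡 d) (𝓡 d) :=
  ⟨(contMDiffOn_of_mem_maximalAtlas hφ).mdifferentiableOn (by simp),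
    (contMDiffOn_symm_of_mem_maximalAtlas hφ).mdifferentiableOn (by simp)⟩

variable [IsManifold (𝓡 d) ∞ M]

/-- The metric in the coordinates of a chart, as a bilinear form on the model space. -/
def coordForm (g : SmoothMetric d M) (φ : OpenPartialHomeomorph M (EuclideanSpace ℝ (Fin d)))
    (y : EuclideanSpace ℝ (Fin d)) : LinearMap.BilinForm ℝ (EuclideanSpace ℝ (Fin d)) :=
  LinearMap.mk₂ ℝ (fun v w => g.inner (φ.symm y) (mfderiv (𝓡 d) (𝓡 d) φ.symm y v)
      (mfderiv (𝓡 d) (𝓡 d) φ.symm y w))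
    (fun v v' w => by
      rw [show mfderiv (𝓡 d) (𝓡 d) φ.symm y (v + v') = _ from map_add _ _ _, map_add]; rfl)
    (fun c v w => by
      rw [show mfderiv (𝓡 d) (𝓡 d) φ.symm y (c • v) = _ from map_smul _ _ _, map_smul]; rfl)
    (fun v w w' => by
      rw [show mfderiv (𝓡 d) (𝓡 d) φ.symm y (w + w') = _ from map_add _ _ _, map_add])
    (fun c v w => by
      rw [show mfderiv (𝓡 d) (𝓡 d) φ.symm y (c • w) = _ from map_smul _ _ _, map_smul])

theorem coordForm_apply (g : SmoothMetric d M)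
    (φ : OpenPartialHomeomorph M (EuclideanSpace ℝ (Fin d))) (y v w : EuclideanSpace ℝ (Fin d)) :
    coordForm g φ y v w = g.inner (φ.symm y) (mfderiv (𝓡 d) (𝓡 d) φ.symm y v)
      (mfderiv (𝓡 d) (𝓡 d) φ.symm y w) := rfl

theorem gramMatrix_eq_toMatrix (g : SmoothMetric d M)
    (φ : OpenPartialHomeomorph M (EuclideanSpace ℝ (Fin d))) (y : EuclideanSpace ℝ (Fin d)) :
    gramMatrix g φ y =
      LinearMap.BilinForm.toMatrix (EuclideanSpace.basisFun (Fin d) ℝ).toBasis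
        (coordForm g φ y) := by
  ext i j
  simp [gramMatrix, coordForm_apply, LinearMap.BilinForm.toMatrix_apply]

/-- The inverse chart has injective differential, so the pulled-back metric stays positive definite.
-/
theorem gramMatrix_det_pos (g : SmoothMetric d M)
    {φ : OpenPartialHomeomorph M (EuclideanSpace ℝ (Fin d))}
    (hφ : φ ∈ IsManifold.maximalAtlas (𝓡 d) ∞ M) {y : EuclideanSpace ℝ (Fin d)}
    (hy : y ∈ φ.target) : 0 < (gramMatrix g φ y).det := by
  have hinj := (OpenPartialHomeomorph.mDifferentiable_of_mem_maximalAtlas hφ).symm.mfderiv_injective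
    (x := y) hy
  refine Matrix.PosDef.det_pos (Matrix.PosDef.of_dotProduct_mulVec_pos ?_ fun x hx => ?_)
  · ext i j
    simp only [gramMatrix, Matrix.conjTranspose_apply, Matrix.of_apply, star_trivial]
    exact g.symm _ _ _
  · have h1 := LinearMap.BilinForm.dotProduct_toMatrix_mulVec
      (EuclideanSpace.basisFun (Fin d) ℝ).toBasis (coordForm g φ y) x x
    rw [gramMatrix_eq_toMatrix, star_trivial, h1]
    refine g.pos _ _ fun h0 => hx ?_
    rw [← map_zero (mfderiv (𝓡 d) (𝓡 d) φ.symm y)] at h0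
    have h2 : (EuclideanSpace.basisFun (Fin d) ℝ).toBasis.equivFun.symm x = 0 := hinj h0
    exact (map_eq_zero_iff _ (LinearEquiv.injective _)).1 h2

/-- The coordinate fields are images of constant fields under the tangent map of the inverse chart,
hence smooth along it; the smooth bilinear form g is then evaluated on them. -/
theorem contDiffOn_gramMatrix_apply (g : SmoothMetric d M)
    {φ : OpenPartialHomeomorph M (EuclideanSpace ℝ (Fin d))}
    (hφ : φ ∈ IsManifold.maximalAtlas (𝓡 d) ∞ M) (i j : Fin d) :
    ContDiffOn ℝ ∞ (fun y => gramMatrix g φ y i j) φ.target := by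
  rw [← contMDiffOn_iff_contDiffOn]
  have hsymm := contMDiffOn_symm_of_mem_maximalAtlas hφ
  have hvec : ∀ e : EuclideanSpace ℝ (Fin d), ContMDiffOn (𝓡 d) (𝓡 d).tangent ∞
      (fun y => (⟨φ.symm y, mfderiv (𝓡 d) (𝓡 d) φ.symm y e⟩ : TangentBundle (𝓡 d) M))
      φ.target := by
    intro e
    have h1 := hsymm.contMDiffOn_tangentMapWithin (m := ∞) (by simp)
      φ.open_target.uniqueMDiffOn
    have h2 : ContMDiffOn (𝓡 d) (𝓡 d).tangent ∞
        (fun y => (⟨y, e⟩ : TangentBundle (𝓡 d) (EuclideanSpace ℝ (Fin d)))) φ.target :=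
      contMDiffOn_vectorSpace_iff_contDiffOn.2 contDiffOn_const
    refine (h1.comp h2 fun y hy => hy).congr fun y hy => ?_
    simp only [Function.comp, tangentMapWithin]
    rw [mfderivWithin_of_isOpen φ.open_target hy]
  intro y hy
  have h3 : ContMDiffWithinAt (𝓡 d) ((𝓡 d).prod 𝓘(ℝ)) ∞
      (fun y => Bundle.TotalSpace.mk' ℝ (E := Bundle.Trivial M ℝ) (φ.symm y)
        (gramMatrix g φ y i j)) φ.target y := by
    refine ContMDiffWithinAt.clm_bundle_apply₂ (F₁ := EuclideanSpace ℝ (Fin d))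
      (F₂ := EuclideanSpace ℝ (Fin d)) ?_ (hvec _ y hy) (hvec _ y hy)
    exact ContMDiffAt.comp_contMDiffWithinAt y g.contMDiff.contMDiffAt (hsymm y hy)
  simp only [Bundle.contMDiffWithinAt_totalSpace] at h3
  exact h3.2

theorem contDiffOn_sqrt_det_gramMatrix (g : SmoothMetric d M)
    {φ : OpenPartialHomeomorph M (EuclideanSpace ℝ (Fin d))}
    (hφ : φ ∈ IsManifold.maximalAtlas (𝓡 d) ∞ M) :
    ContDiffOn ℝ ∞ (fun y => √(gramMatrix g φ y).det) φ.target := by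
  refine ContDiffOn.sqrt ?_ fun y hy => (gramMatrix_det_pos g hφ hy).ne'
  simp_rw [Matrix.det_apply]
  exact ContDiffOn.sum fun s _ => (contDiffOn_prod fun i _ =>
    contDiffOn_gramMatrix_apply g hφ _ _).const_smul _

/-- By the chain rule one coordinate form is the pull-back of the other by the differential A of the
transition map. The matrices are related by AᵀGA, and √(det A)² = |det A|. -/
theorem sqrt_det_gramMatrix_transition (g : SmoothMetric d M)
    {φ ψ : OpenPartialHomeomorph M (EuclideanSpace ℝ (Fin d))}
    (hφ : φ ∈ IsManifold.maximalAtlas (𝓡 d) ∞ M) (hψ : ψ ∈ IsManifold.maximalAtlas (𝓡 d) ∞ M)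
    {y : EuclideanSpace ℝ (Fin d)} (hy : y ∈ ψ.target) (hy' : ψ.symm y ∈ φ.source) :
    √(gramMatrix g ψ y).det =
      |(fderiv ℝ (φ ∘ ψ.symm) y).det| * √(gramMatrix g φ (φ (ψ.symm y))).det := by
  have hφd := OpenPartialHomeomorph.mDifferentiable_of_mem_maximalAtlas hφ
  have hψd := OpenPartialHomeomorph.mDifferentiable_of_mem_maximalAtlas hψ
  have h1 : mfderiv (𝓡 d) (𝓡 d) ψ.symm y =
      (mfderiv (𝓡 d) (𝓡 d) φ.symm (φ (ψ.symm y))).comp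
        (mfderiv (𝓡 d) (𝓡 d) (φ ∘ ψ.symm) y) := by
    have hev : ψ.symm =ᶠ[𝓝 y] φ.symm ∘ (φ ∘ ψ.symm) := by
      filter_upwards [(ψ.continuousAt_symm hy).preimage_mem_nhds (φ.open_source.mem_nhds hy')]
        with z hz
      exact (φ.left_inv hz).symm
    rw [hev.mfderiv_eq]
    exact mfderiv_comp y (hφd.mdifferentiableAt_symm (φ.map_source hy'))
      ((hφd.mdifferentiableAt hy').comp y (hψd.mdifferentiableAt_symm hy))
  have h2 : coordForm g ψ y = (coordForm g φ (φ (ψ.symm y))).comp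
      (fderiv ℝ (φ ∘ ψ.symm) y).toLinearMap (fderiv ℝ (φ ∘ ψ.symm) y).toLinearMap := by
    refine LinearMap.ext₂ fun v w => ?_
    rw [LinearMap.BilinForm.comp_apply, coordForm_apply, coordForm_apply, φ.left_inv hy', h1,
      mfderiv_eq_fderiv]
    rfl
  rw [gramMatrix_eq_toMatrix, gramMatrix_eq_toMatrix, h2,
    LinearMap.BilinForm.toMatrix_comp (EuclideanSpace.basisFun (Fin d) ℝ).toBasis
      (EuclideanSpace.basisFun (Fin d) ℝ).toBasis,
    Matrix.det_mul, Matrix.det_mul, Matrix.det_transpose, LinearMap.det_toMatrix, mul_right_comm,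
    Real.sqrt_mul (mul_self_nonneg _), Real.sqrt_mul_self_eq_abs]

theorem sqrt_det_gramMatrix_rescale {g g' : SmoothMetric d M} {Ω : M → ℝ}
    (h : IsRescaling g g' Ω) (φ : OpenPartialHomeomorph M (EuclideanSpace ℝ (Fin d)))
    (y : EuclideanSpace ℝ (Fin d)) :
    √(gramMatrix g' φ y).det = Ω (φ.symm y) ^ d * √(gramMatrix g φ y).det := by
  have h1 : gramMatrix g' φ y = (Ω (φ.symm y) ^ 2) • gramMatrix g φ y := by
    ext i j
    simp only [gramMatrix, Matrix.of_apply, Matrix.smul_apply, smul_eq_mul]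
    exact h.2.2 _ _ _
  have h0 := (h.2.1 (φ.symm y)).le
  rw [h1, Matrix.det_smul, Fintype.card_fin, ← pow_mul, mul_comm 2 d, pow_mul,
    Real.sqrt_mul (by positivity), Real.sqrt_sq (by positivity)]

end GramMatrix

/-! ### Measurability of charts -/

section Charts

variable {d : ℕ} {M : Type*} [TopologicalSpace M] [MeasurableSpace M] [BorelSpace M]

theorem OpenPartialHomeomorph.measurableSet_target_inter_preimage
    (φ : OpenPartialHomeomorph M (EuclideanSpace ℝ (Fin d))) {s : Set M} (hs : MeasurableSet s) :
    MeasurableSet (φ.target ∩ φ.symm ⁻¹' s) := by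
  have h := (continuousOn_iff_continuous_domRestrict.1 φ.continuousOn_symm).measurable hs
  have h2 := φ.open_target.measurableSet.subtype_image h
  convert h2 using 1
  ext y
  simp [Set.domRestrict, and_comm]

theorem OpenPartialHomeomorph.aemeasurable_symm
    (φ : OpenPartialHomeomorph M (EuclideanSpace ℝ (Fin d))) :
    AEMeasurable φ.symm (volume.restrict φ.target) :=
  φ.continuousOn_symm.aemeasurable φ.open_target.measurableSet

end Charts

/-! ### The Riemannian volume in charts and under rescaling -/

section Volume

variable {d : ℕ} {M : Type*} [TopologicalSpace M]
  [ChartedSpace (EuclideanSpace ℝ (Fin d)) M] [IsManifold (𝓡 d) ∞ M]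

theorem aemeasurable_density (g : SmoothMetric d M)
    {φ : OpenPartialHomeomorph M (EuclideanSpace ℝ (Fin d))}
    (hφ : φ ∈ IsManifold.maximalAtlas (𝓡 d) ∞ M) :
    AEMeasurable (fun y => ENNReal.ofReal √(gramMatrix g φ y).det) (volume.restrict φ.target) :=
  ((contDiffOn_sqrt_det_gramMatrix g hφ).continuousOn.aemeasurable
    φ.open_target.measurableSet).ennreal_ofReal

variable [MeasurableSpace M] [BorelSpace M]

theorem aemeasurable_symm_withDensity (g : SmoothMetric d M)
    (φ : OpenPartialHomeomorph M (EuclideanSpace ℝ (Fin d))) :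
    AEMeasurable φ.symm ((volume.restrict φ.target).withDensity
      fun y => ENNReal.ofReal √(gramMatrix g φ y).det) :=
  φ.aemeasurable_symm.mono_ac (withDensity_absolutelyContinuous _ _)

theorem chartVolume_apply (g : SmoothMetric d M)
    (φ : OpenPartialHomeomorph M (EuclideanSpace ℝ (Fin d))) {s : Set M} (hs : MeasurableSet s) :
    chartVolume g φ s =
      ∫⁻ y in φ.target ∩ φ.symm ⁻¹' s, ENNReal.ofReal √(gramMatrix g φ y).det := by
  rw [chartVolume, Measure.map_apply_of_aemeasurable (aemeasurable_symm_withDensity g φ) hs,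
    withDensity_apply', Measure.restrict_restrict' φ.open_target.measurableSet, inter_comm]

/-- Change of variables along the transition map. Only the overlap of the two domains is reached,
hence an inequality; it is what the supremum of the chart measures needs. -/
theorem chartVolume_inter_source_le (g : SmoothMetric d M)
    {φ ψ : OpenPartialHomeomorph M (EuclideanSpace ℝ (Fin d))}
    (hφ : φ ∈ IsManifold.maximalAtlas (𝓡 d) ∞ M) (hψ : ψ ∈ IsManifold.maximalAtlas (𝓡 d) ∞ M)
    {s : Set M} (hs : MeasurableSet s) :
    chartVolume g ψ (s ∩ φ.source) ≤ chartVolume g φ s := by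
  have hsφ : MeasurableSet (s ∩ φ.source) := hs.inter φ.open_source.measurableSet
  set N := ψ.target ∩ ψ.symm ⁻¹' (s ∩ φ.source) with hN
  have hNm : MeasurableSet N := ψ.measurableSet_target_inter_preimage hsφ
  have hφd := OpenPartialHomeomorph.mDifferentiable_of_mem_maximalAtlas hφ
  have hψd := OpenPartialHomeomorph.mDifferentiable_of_mem_maximalAtlas hψ
  have hder : ∀ y ∈ N, HasFDerivWithinAt (φ ∘ ψ.symm) (fderiv ℝ (φ ∘ ψ.symm) y) N y := by
    intro y hy
    have h := (hφd.mdifferentiableAt hy.2.2).comp y (hψd.mdifferentiableAt_symm hy.1)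
    exact (mdifferentiableAt_iff_differentiableAt.1 h).hasFDerivAt.hasFDerivWithinAt
  have hinj : InjOn (φ ∘ ψ.symm) N := by
    intro y hy z hz h
    exact ψ.symm.injOn hy.1 hz.1 (φ.injOn hy.2.2 hz.2.2 h)
  rw [chartVolume_apply g ψ hsφ, chartVolume_apply g φ hs]
  calc ∫⁻ y in N, ENNReal.ofReal √(gramMatrix g ψ y).det
      = ∫⁻ y in N, ENNReal.ofReal |(fderiv ℝ (φ ∘ ψ.symm) y).det| *
          ENNReal.ofReal √(gramMatrix g φ ((φ ∘ ψ.symm) y)).det := by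
        refine setLIntegral_congr_fun hNm fun y hy => ?_
        rw [← ENNReal.ofReal_mul (abs_nonneg _)]
        exact congrArg _ (sqrt_det_gramMatrix_transition g hφ hψ hy.1 hy.2.2)
    _ = ∫⁻ x in (φ ∘ ψ.symm) '' N, ENNReal.ofReal √(gramMatrix g φ x).det :=
        (lintegral_image_eq_lintegral_abs_det_fderiv_mul volume hNm hder hinj
          (fun x => ENNReal.ofReal √(gramMatrix g φ x).det)).symm
    _ ≤ _ := by
        refine lintegral_mono_set ?_
        rintro _ ⟨y, hy, rfl⟩
        refine ⟨φ.map_source hy.2.2, ?_⟩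
        simp only [mem_preimage, Function.comp_apply, φ.left_inv hy.2.2]
        exact hy.2.1

theorem riemannianVolume_restrict_source (g : SmoothMetric d M)
    {φ : OpenPartialHomeomorph M (EuclideanSpace ℝ (Fin d))}
    (hφ : φ ∈ IsManifold.maximalAtlas (𝓡 d) ∞ M) :
    (riemannianVolume g).restrict φ.source = chartVolume g φ := by
  have hU : MeasurableSet φ.source := φ.open_source.measurableSet
  -- A common upper bound for all chart measures that is sharp on the domain of φ and trivial off
  -- it, so nothing has to be computed about the supremum elsewhere.
  have hle : riemannianVolume g ≤ chartVolume g φ + (⊤ : Measure M).restrict φ.sourceᶜ := by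
    refine iSup_le fun ψ => Measure.le_iff.2 fun s hs => ?_
    rw [← measure_inter_add_sdiff s hU, Measure.add_apply, Measure.restrict_apply hs]
    refine add_le_add (chartVolume_inter_source_le g hφ ψ.2 hs) ?_
    rw [Set.sdiff_eq]
    exact Measure.le_iff'.1 le_top _
  refine Measure.ext fun s hs => le_antisymm ?_ ?_
  · rw [Measure.restrict_apply hs]
    refine (Measure.le_iff'.1 hle _).trans ?_
    rw [Measure.add_apply, Measure.restrict_apply (hs.inter hU), inter_assoc,
      inter_compl_self, inter_empty, measure_empty, add_zero]
    exact measure_mono inter_subset_left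
  · rw [Measure.restrict_apply hs]
    refine le_trans (le_of_eq ?_) (Measure.le_iff'.1
      (le_iSup (fun φ : IsManifold.maximalAtlas (𝓡 d) ∞ M => chartVolume g φ.1) ⟨φ, hφ⟩) _)
    rw [chartVolume_apply g φ hs, chartVolume_apply g φ (hs.inter hU)]
    congr 2
    ext y
    simp only [mem_inter_iff, mem_preimage]
    exact ⟨fun h => ⟨h.1, h.2, φ.map_target h.1⟩, fun h => ⟨h.1, h.2.1⟩⟩

/-- Integrals with respect to the Riemannian volume, in the coordinates of a chart. -/
theorem setIntegral_riemannianVolume (g : SmoothMetric d M)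
    {φ : OpenPartialHomeomorph M (EuclideanSpace ℝ (Fin d))}
    (hφ : φ ∈ IsManifold.maximalAtlas (𝓡 d) ∞ M) {D : Set M} (hD : MeasurableSet D) {f : M → ℝ}
    (hf : Measurable f) (h0 : ∀ x ∉ φ.source, f x = 0) :
    ∫ x in D, f x ∂(riemannianVolume g) =
      ∫ y in φ.target ∩ φ.symm ⁻¹' D, √(gramMatrix g φ y).det * f (φ.symm y) := by
  have hU : MeasurableSet φ.source := φ.open_source.measurableSet
  have h1 : ∫ x in D, f x ∂(riemannianVolume g) = ∫ x, D.indicator f x ∂(chartVolume g φ) := by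
    rw [← riemannianVolume_restrict_source g hφ, ← integral_indicator hD]
    refine (setIntegral_eq_integral_of_forall_compl_eq_zero fun x hx => ?_).symm
    simp [Set.indicator, h0 x hx]
  rw [h1, chartVolume, integral_map (aemeasurable_symm_withDensity g φ)
    (hf.indicator hD).aestronglyMeasurable, integral_withDensity_eq_integral_toReal_smul₀
    (aemeasurable_density g hφ) (Eventually.of_forall fun _ => ENNReal.ofReal_lt_top)]
  rw [setIntegral_eq_of_subset_of_forall_sdiff_eq_zero (s := φ.target ∩ φ.symm ⁻¹' D)
    φ.open_target.measurableSet inter_subset_left]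
  · refine setIntegral_congr_fun (φ.measurableSet_target_inter_preimage hD) fun y hy => ?_
    rw [ENNReal.toReal_ofReal (Real.sqrt_nonneg _), smul_eq_mul,
      indicator_of_mem (show φ.symm y ∈ D from hy.2)]
  · intro y hy
    have : φ.symm y ∉ D := fun h => hy.2 ⟨hy.1, h⟩
    rw [indicator_of_notMem this, smul_zero]

/-- The continuous density √det is bounded on a small coordinate ball. Local finiteness makes
continuous functions integrable over the compact region. -/
instance isLocallyFiniteMeasure_riemannianVolume (g : SmoothMetric d M) :
    IsLocallyFiniteMeasure (riemannianVolume g) := by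
  refine ⟨fun x => ?_⟩
  set φ := chartAt (EuclideanSpace ℝ (Fin d)) x
  have hφ : φ ∈ IsManifold.maximalAtlas (𝓡 d) ∞ M := IsManifold.chart_mem_maximalAtlas x
  have hx : x ∈ φ.source := mem_chart_source _ x
  have hy : φ x ∈ φ.target := φ.map_source hx
  have hc : ContinuousAt (fun y => √(gramMatrix g φ y).det) (φ x) :=
    (contDiffOn_sqrt_det_gramMatrix g hφ).continuousOn.continuousAt (φ.open_target.mem_nhds hy)
  obtain ⟨r, hr, hB⟩ := Metric.eventually_nhds_iff_ball.1
    (hc.eventually (gt_mem_nhds (lt_add_one √(gramMatrix g φ (φ x)).det)))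
  set C := √(gramMatrix g φ (φ x)).det + 1
  have hUo : IsOpen (φ.source ∩ φ ⁻¹' Metric.ball (φ x) r) :=
    φ.isOpen_inter_preimage Metric.isOpen_ball
  refine ⟨φ.source ∩ φ ⁻¹' Metric.ball (φ x) r,
    hUo.mem_nhds ⟨hx, Metric.mem_ball_self hr⟩, ?_⟩
  have h1 : riemannianVolume g (φ.source ∩ φ ⁻¹' Metric.ball (φ x) r) =
      chartVolume g φ (φ.source ∩ φ ⁻¹' Metric.ball (φ x) r) := by
    rw [← riemannianVolume_restrict_source g hφ, Measure.restrict_apply hUo.measurableSet,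
      inter_right_comm, inter_self]
  rw [h1, chartVolume_apply g φ hUo.measurableSet]
  have hsub : φ.target ∩ φ.symm ⁻¹' (φ.source ∩ φ ⁻¹' Metric.ball (φ x) r) ⊆
      Metric.ball (φ x) r := by
    rintro y ⟨hy, -, hy2⟩
    rwa [mem_preimage, φ.right_inv hy] at hy2
  calc _ ≤ ∫⁻ y in Metric.ball (φ x) r, ENNReal.ofReal √(gramMatrix g φ y).det :=
        lintegral_mono_set hsub
    _ ≤ ∫⁻ _ in Metric.ball (φ x) r, ENNReal.ofReal C :=
        setLIntegral_mono measurable_const fun y hy => ENNReal.ofReal_le_ofReal (hB y hy).le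
    _ < ⊤ := by
        rw [setLIntegral_const]
        exact ENNReal.mul_lt_top ENNReal.ofReal_lt_top measure_ball_lt_top

/-- In each chart √det scales by Ω^d; second countability reduces equality of the measures to
countably many charts. -/
theorem riemannianVolume_rescale [SecondCountableTopology M] {g g' : SmoothMetric d M} {Ω : M → ℝ}
    (h : IsRescaling g g' Ω) :
    riemannianVolume g' = (riemannianVolume g).withDensity fun x => ENNReal.ofReal (Ω x ^ d) := by
  have hΩ : Measurable fun x => ENNReal.ofReal (Ω x ^ d) :=
    (h.1.continuous.pow d).measurable.ennreal_ofReal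
  obtain ⟨t, ht, hcov⟩ := TopologicalSpace.isOpen_iUnion_countable
    (fun x : M => (chartAt (EuclideanSpace ℝ (Fin d)) x).source) fun x => (chartAt _ x).open_source
  have : Countable t := ht.to_subtype
  refine Measure.ext_of_iUnion_eq_univ
    (s := fun x : t => (chartAt (EuclideanSpace ℝ (Fin d)) x.1).source) ?_ fun x => ?_
  · rw [← biUnion_eq_iUnion t fun x _ => (chartAt (EuclideanSpace ℝ (Fin d)) x).source, hcov]
    exact eq_univ_of_forall fun x => mem_iUnion.2 ⟨x, mem_chart_source _ x⟩
  · set φ := chartAt (EuclideanSpace ℝ (Fin d)) x.1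
    have hφ : φ ∈ IsManifold.maximalAtlas (𝓡 d) ∞ M := IsManifold.chart_mem_maximalAtlas x.1
    rw [restrict_withDensity φ.open_source.measurableSet, riemannianVolume_restrict_source g' hφ,
      riemannianVolume_restrict_source g hφ]
    refine Measure.ext fun s hs => ?_
    have hN := φ.measurableSet_target_inter_preimage hs
    rw [chartVolume_apply g' φ hs, withDensity_apply _ hs, ← lintegral_indicator hs, chartVolume,
      lintegral_map' (hΩ.indicator hs).aemeasurable (aemeasurable_symm_withDensity g φ)]
    refine Eq.trans ?_ (lintegral_withDensity_eq_lintegral_mul₀ (aemeasurable_density g hφ)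
        ((hΩ.indicator hs).comp_aemeasurable φ.aemeasurable_symm)).symm
    rw [← inter_eq_left.2 (inter_subset_left : φ.target ∩ φ.symm ⁻¹' s ⊆ φ.target),
      ← Measure.restrict_restrict hN, ← lintegral_indicator hN]
    refine setLIntegral_congr_fun φ.open_target.measurableSet fun y hy => ?_
    by_cases hys : φ.symm y ∈ s
    · rw [indicator_of_mem (show y ∈ φ.target ∩ φ.symm ⁻¹' s from ⟨hy, hys⟩),
        sqrt_det_gramMatrix_rescale h, ENNReal.ofReal_mul (pow_nonneg (h.2.1 _).le d), mul_comm]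
      simp [indicator_of_mem hys]
    · rw [indicator_of_notMem fun hy' => hys hy'.2]
      simp [indicator_of_notMem hys]

theorem setIntegral_riemannianVolume_rescale [SecondCountableTopology M] {g g' : SmoothMetric d M}
    {Ω : M → ℝ} (h : IsRescaling g g' Ω) {D : Set M} (hD : MeasurableSet D) (f : M → ℝ) :
    ∫ x in D, f x ∂(riemannianVolume g') = ∫ x in D, Ω x ^ d * f x ∂(riemannianVolume g) := by
  have hΩ : Measurable fun x => ENNReal.ofReal (Ω x ^ d) :=
    (h.1.continuous.pow d).measurable.ennreal_ofReal
  rw [riemannianVolume_rescale h, setIntegral_withDensity_eq_setIntegral_toReal_smul hΩ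
    (Eventually.of_forall fun _ => ENNReal.ofReal_lt_top) _ hD]
  congr 1
  funext x
  rw [ENNReal.toReal_ofReal (pow_nonneg (h.2.1 x).le d), smul_eq_mul]

end Volume

/-! ### Making the defining function a coordinate -/

section Straightening

variable {d : ℕ}

/-- A map that changes only the `i`-th coordinate, into a function with nonvanishing `i`-th partial
derivative, is a local diffeomorphism. -/
theorem exists_openPartialHomeomorph_update {w : EuclideanSpace ℝ (Fin d) → ℝ}
    {U : Set (EuclideanSpace ℝ (Fin d))} (hU : IsOpen U) (hw : ContDiffOn ℝ ∞ w U) (i : Fin d)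
    {a : EuclideanSpace ℝ (Fin d)} (ha : a ∈ U)
    (hi : fderiv ℝ w a (EuclideanSpace.single i 1) ≠ 0) :
    ∃ e : OpenPartialHomeomorph (EuclideanSpace ℝ (Fin d)) (EuclideanSpace ℝ (Fin d)),
      a ∈ e.source ∧ e.source ⊆ U ∧ ContDiffOn ℝ ∞ e e.source ∧
      ContDiffOn ℝ ∞ e.symm e.target ∧ ∀ y, e y i = w y ∧ ∀ j, j ≠ i → e y j = y j := by
  set ei : EuclideanSpace ℝ (Fin d) := EuclideanSpace.single i 1 with hei
  set f : EuclideanSpace ℝ (Fin d) → EuclideanSpace ℝ (Fin d) := fun y => y + (w y - y i) • ei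
    with hfdef
  have hfc : ∀ y, f y i = w y ∧ ∀ j, j ≠ i → f y j = y j := by
    intro y
    refine ⟨by simp [hfdef, hei], fun j hj => by simp [hfdef, hei, hj]⟩
  have hfs : ∀ y ∈ U, ContDiffAt ℝ ∞ f y := by
    intro y hy
    have h1 : ContDiffAt ℝ ∞ w y := hw.contDiffAt (hU.mem_nhds hy)
    fun_prop
  have hfd : ∀ y ∈ U, fderiv ℝ w y ei ≠ 0 →
      ∃ L : EuclideanSpace ℝ (Fin d) ≃L[ℝ] EuclideanSpace ℝ (Fin d),
        HasFDerivAt f (L : EuclideanSpace ℝ (Fin d) →L[ℝ] EuclideanSpace ℝ (Fin d)) y := by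
    intro y hy hne
    have h1 : HasFDerivAt w (fderiv ℝ w y) y :=
      ((hw.contDiffAt (hU.mem_nhds hy)).differentiableAt (by simp)).hasFDerivAt
    have h2 := (hasFDerivAt_id (𝕜 := ℝ) y).add ((h1.sub
      (EuclideanSpace.proj i : EuclideanSpace ℝ (Fin d) →L[ℝ] ℝ).hasFDerivAt).smul_const ei)
    set A := ContinuousLinearMap.id ℝ (EuclideanSpace ℝ (Fin d)) + (fderiv ℝ w y -
      (EuclideanSpace.proj i : EuclideanSpace ℝ (Fin d) →L[ℝ] ℝ)).smulRight ei with hA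
    -- A vector in the kernel has vanishing coordinates j ≠ i, and on the i-th axis A is
    -- multiplication by ∂ᵢw ≠ 0.
    have hinj : Function.Injective A.toLinearMap := by
      refine (injective_iff_map_eq_zero _).2 fun v hv => ?_
      have hAv : v + (fderiv ℝ w y v - v i) • ei = 0 := hv
      have hj : ∀ j, j ≠ i → v j = 0 := fun j hj => by
        have := congrArg (fun z : EuclideanSpace ℝ (Fin d) => z j) hAv
        simpa [hei, hj] using this
      have hvi : v = v i • ei := by
        ext j
        by_cases hji : j = i
        · subst hji; simp [hei]
        · simp [hei, hji, hj j hji]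
      have hwv : fderiv ℝ w y v = 0 := by
        have := congrArg (fun z : EuclideanSpace ℝ (Fin d) => z i) hAv
        simpa [hei] using this
      rw [hvi, map_smul, smul_eq_mul] at hwv
      rw [hvi, (mul_eq_zero.1 hwv).resolve_right hne, zero_smul]
    refine ⟨(LinearEquiv.ofInjectiveEndo A.toLinearMap hinj).toContinuousLinearEquiv, ?_⟩
    convert! h2 using 1
  obtain ⟨L, hL⟩ := hfd a ha hi
  set e := (hfs a ha).toOpenPartialHomeomorph f hL (by simp) with he
  -- Restricting to ∂ᵢw ≠ 0 keeps the differential invertible at every point of the source, so the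
  -- inverse is smooth on the whole target and not only at the image of a.
  have hV : IsOpen (U ∩ (fun y => fderiv ℝ w y ei) ⁻¹' {0}ᶜ) := by
    refine ContinuousOn.isOpen_inter_preimage ?_ hU isOpen_compl_singleton
    exact (hw.continuousOn_fderiv_of_isOpen hU (by simp)).clm_apply continuousOn_const
  set V := U ∩ (fun y => fderiv ℝ w y ei) ⁻¹' {0}ᶜ
  have hes : (e.restrOpen V hV).source = e.source ∩ V := rfl
  refine ⟨e.restrOpen V hV, ?_, ?_, ?_, ?_, hfc⟩
  · exact ⟨(hfs a ha).mem_toOpenPartialHomeomorph_source hL (by simp), ha, hi⟩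
  · exact fun y hy => hy.2.1
  · exact fun y hy => (hfs y hy.2.1).contDiffWithinAt
  · intro y hy
    have hys := (e.restrOpen V hV).map_target hy
    obtain ⟨L', hL'⟩ := hfd _ hys.2.1 hys.2.2
    exact ((e.restrOpen V hV).contDiffAt_symm hy hL' (hfs _ hys.2.1)).contDiffWithinAt

variable {M : Type*} [TopologicalSpace M] [ChartedSpace (EuclideanSpace ℝ (Fin d)) M]
  [IsManifold (𝓡 d) ∞ M]

/-- A chart in which the zero locus of a defining function is a coordinate hyperplane can be
changed along that coordinate into one whose coordinate is the defining function. -/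
theorem exists_straightened_chart {u : M → ℝ} (hu : ContMDiff (𝓡 d) 𝓘(ℝ, ℝ) ∞ u)
    {φ : OpenPartialHomeomorph M (EuclideanSpace ℝ (Fin d))}
    (hφ : φ ∈ IsManifold.maximalAtlas (𝓡 d) ∞ M) {i : Fin d} {p : M} (hp : p ∈ φ.source)
    (hdu : mfderiv (𝓡 d) 𝓘(ℝ, ℝ) u p ≠ 0)
    (hzero : ∀ x ∈ φ.source, φ x i = 0 → u x = 0) (hpi : φ p i = 0) :
    ∃ ψ ∈ IsManifold.maximalAtlas (𝓡 d) ∞ M, p ∈ ψ.source ∧ ψ.source ⊆ φ.source ∧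
      ∀ x ∈ ψ.source, ψ x i = u x ∧ ∀ j, j ≠ i → ψ x j = φ x j := by
  have hsymm := contMDiffOn_symm_of_mem_maximalAtlas hφ
  have hφd := OpenPartialHomeomorph.mDifferentiable_of_mem_maximalAtlas hφ
  set w : EuclideanSpace ℝ (Fin d) → ℝ := u ∘ φ.symm
  have hw : ContDiffOn ℝ ∞ w φ.target := by
    rw [← contMDiffOn_iff_contDiffOn]
    exact hu.comp_contMDiffOn hsymm
  have ha : φ p ∈ φ.target := φ.map_source hp
  have hwd : HasFDerivAt w (fderiv ℝ w (φ p)) (φ p) :=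
    ((hw.contDiffAt (φ.open_target.mem_nhds ha)).differentiableAt (by simp)).hasFDerivAt
  -- Lines in the directions j ≠ i stay in the hyperplane, where w vanishes; so du ≠ 0 can only come
  -- from ∂ᵢw.
  have hj : ∀ j, j ≠ i → fderiv ℝ w (φ p) (EuclideanSpace.single j 1) = 0 := by
    intro j hj
    have hline : HasDerivAt (fun t : ℝ => φ p + t • EuclideanSpace.single j (1 : ℝ))
        (EuclideanSpace.single j (1 : ℝ)) 0 := by
      simpa using ((hasDerivAt_id (0 : ℝ)).smul_const
        (EuclideanSpace.single j (1 : ℝ))).const_add (φ p)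
    have h1 : HasDerivAt (fun t : ℝ => w (φ p + t • EuclideanSpace.single j (1 : ℝ)))
        (fderiv ℝ w (φ p) (EuclideanSpace.single j 1)) 0 := by
      have hwd' : HasFDerivAt w (fderiv ℝ w (φ p))
          (φ p + (0 : ℝ) • EuclideanSpace.single j (1 : ℝ)) := by simpa using hwd
      exact hwd'.comp_hasDerivAt (0 : ℝ) hline
    have hz : (fun t : ℝ => w (φ p + t • EuclideanSpace.single j (1 : ℝ))) =ᶠ[𝓝 0]
        fun _ => 0 := by
      have hc : ContinuousAt (fun t : ℝ => φ p + t • EuclideanSpace.single j (1 : ℝ)) 0 :=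
        hline.continuousAt
      filter_upwards [hc.preimage_mem_nhds (φ.open_target.mem_nhds (by simpa using ha))]
        with t ht
      refine hzero _ (φ.map_target ht) ?_
      rw [φ.right_inv ht]
      simp [hpi, hj.symm]
    exact h1.unique ((hasDerivAt_const (0 : ℝ) (0 : ℝ)).congr_of_eventuallyEq hz)
  have hi : fderiv ℝ w (φ p) (EuclideanSpace.single i 1) ≠ 0 := by
    intro hi
    refine hdu ?_
    have hzero' : fderiv ℝ w (φ p) = 0 := by
      refine ContinuousLinearMap.coe_injective
        ((EuclideanSpace.basisFun (Fin d) ℝ).toBasis.ext fun j => ?_)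
      by_cases hji : j = i
      · subst hji; simpa using hi
      · simpa using hj j hji
    have hev : u =ᶠ[𝓝 p] w ∘ φ := by
      filter_upwards [φ.open_source.mem_nhds hp] with x hx
      simp [w, φ.left_inv hx]
    rw [hev.mfderiv_eq, mfderiv_comp p
      (mdifferentiableAt_iff_differentiableAt.2 hwd.differentiableAt) (hφd.mdifferentiableAt hp),
      mfderiv_eq_fderiv, hzero']
    exact ContinuousLinearMap.zero_comp _
  obtain ⟨e, hae, heU, hes, het, hec⟩ :=
    exists_openPartialHomeomorph_update φ.open_target hw i ha hi
  refine ⟨φ.trans e, ?_, ?_, ?_, ?_⟩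
  · rw [IsManifold.mem_maximalAtlas_iff_contMDiffOn]
    rw [← contMDiffOn_iff_contDiffOn] at hes het
    refine ⟨?_, ?_⟩
    · refine hes.comp ((contMDiffOn_of_mem_maximalAtlas hφ).mono ?_) ?_
      · simp
      · intro x hx
        simpa using hx.2
    · refine hsymm.comp (het.mono ?_) ?_
      · simp
      · intro x hx
        simpa using hx.2
  · simpa using ⟨hp, hae⟩
  · simp
  · intro x hx
    have hxs : x ∈ φ.source := by simp at hx; exact hx.1
    refine ⟨?_, fun j hj => ?_⟩
    · simp [(hec (φ x)).1, w, φ.left_inv hxs]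
    · simp [(hec (φ x)).2 j hj]

end Straightening

/-! ### Splitting off one Euclidean coordinate -/

section SplitCoordinate

variable {n : ℕ}

/-- Euclidean space as the product of its `i`-th coordinate axis with the other coordinates. -/
def splitCoord (i : Fin (n + 1)) : ℝ × (Fin n → ℝ) ≃ᵐ EuclideanSpace ℝ (Fin (n + 1)) :=
  (MeasurableEquiv.piFinSuccAbove (fun _ => ℝ) i).symm.trans
    (MeasurableEquiv.toLp 2 (Fin (n + 1) → ℝ))

theorem splitCoord_apply (i : Fin (n + 1)) (p : ℝ × (Fin n → ℝ)) :
    splitCoord i p = WithLp.toLp 2 (i.insertNth p.1 p.2) := rfl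

@[simp]
theorem splitCoord_apply_same (i : Fin (n + 1)) (p : ℝ × (Fin n → ℝ)) :
    splitCoord i p i = p.1 := by
  simp [splitCoord_apply]

@[simp]
theorem splitCoord_apply_succAbove (i : Fin (n + 1)) (p : ℝ × (Fin n → ℝ)) (j : Fin n) :
    splitCoord i p (i.succAbove j) = p.2 j := by
  simp [splitCoord_apply]

theorem splitCoord_symm_apply (i : Fin (n + 1)) (y : EuclideanSpace ℝ (Fin (n + 1))) :
    (splitCoord i).symm y = (y i, fun j => y (i.succAbove j)) := rfl

theorem contDiff_splitCoord (i : Fin (n + 1)) : ContDiff ℝ ∞ (splitCoord (n := n) i) := by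
  rw [contDiff_euclidean]
  intro j
  induction j using i.succAboveCases with
  | x => simpa using contDiff_fst
  | p j =>
    simp only [splitCoord_apply_succAbove]
    fun_prop

theorem continuous_splitCoord_symm (i : Fin (n + 1)) : Continuous (splitCoord (n := n) i).symm := by
  simp_rw [show ((splitCoord (n := n) i).symm : _ → _) = fun y => (y i, fun j => y (i.succAbove j))
    from funext (splitCoord_symm_apply i)]
  fun_prop

theorem measurePreserving_splitCoord (i : Fin (n + 1)) :
    MeasurePreserving (splitCoord (n := n) i) := by
  have h1 := (volume_preserving_piFinSuccAbove (fun _ : Fin (n + 1) => ℝ) i).symm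
  have h2 := PiLp.volume_preserving_toLp (Fin (n + 1))
  exact h2.comp h1

end SplitCoordinate

/-! ### Reduction of chart integrals to a product domain -/

section ChartIntegral

variable {n : ℕ} {M : Type*} [TopologicalSpace M] [T2Space M]
  [ChartedSpace (EuclideanSpace ℝ (Fin (n + 1))) M] [IsManifold (𝓡 (n + 1)) ∞ M]
  [MeasurableSpace M] [BorelSpace M]

/-- In a chart in which `D` is a product along the `i`-th coordinate, integrals over `D` are
integrals against a smooth compactly supported weight over a product. -/
theorem exists_weight_setIntegral (g : SmoothMetric (n + 1) M)
    {ψ : OpenPartialHomeomorph M (EuclideanSpace ℝ (Fin (n + 1)))}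
    (hψ : ψ ∈ IsManifold.maximalAtlas (𝓡 (n + 1)) ∞ M) (i : Fin (n + 1)) {D : Set M}
    (hD : IsCompact D)
    (hprod : ∀ x ∈ ψ.source, ∀ y ∈ ψ.source, (∀ j, j ≠ i → ψ x j = ψ y j) → (x ∈ D ↔ y ∈ D))
    {f : M → ℝ} (hf : ContMDiff (𝓡 (n + 1)) 𝓘(ℝ, ℝ) ∞ f) (hfc : HasCompactSupport f)
    (hfψ : tsupport f ⊆ ψ.source) :
    ∃ (W : ℝ × (Fin n → ℝ) → ℝ) (B : Set (Fin n → ℝ)), ContDiff ℝ ∞ W ∧ HasCompactSupport W ∧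
      tsupport W ⊆ splitCoord i ⁻¹' ψ.target ∧ IsCompact B ∧
      ∀ (Φ : M → ℝ) (Φ' : ℝ × (Fin n → ℝ) → ℝ), Measurable Φ →
        (∃ C, ∀ x ∈ tsupport f, |Φ x| ≤ C) →
        (∀ p ∈ splitCoord i ⁻¹' ψ.target, Φ (ψ.symm (splitCoord i p)) = Φ' p) →
        Integrable (fun p => W p * Φ' p) (volume.prod (volume.restrict B)) ∧
        ∫ x in D, f x * Φ x ∂(riemannianVolume g) =
          ∫ p, W p * Φ' p ∂(volume.prod (volume.restrict B)) := by
  classical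
  have hsymm := contMDiffOn_symm_of_mem_maximalAtlas hψ
  set e := splitCoord (n := n) i with he
  have hec : Continuous e := (contDiff_splitCoord i).continuous
  set T : Set (ℝ × (Fin n → ℝ)) := e ⁻¹' ψ.target with hT
  have hTo : IsOpen T := ψ.open_target.preimage hec
  set Kc : Set (EuclideanSpace ℝ (Fin (n + 1))) := ψ '' tsupport f with hKc
  have hKcc : IsCompact Kc := hfc.isCompact.image_of_continuousOn (ψ.continuousOn.mono hfψ)
  set Kp : Set (ℝ × (Fin n → ℝ)) := e.symm '' Kc with hKp
  have hKpc : IsCompact Kp := hKcc.image (continuous_splitCoord_symm i)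
  have hKpe : ∀ p, p ∈ Kp ↔ e p ∈ Kc := fun p =>
    ⟨by rintro ⟨y, hy, rfl⟩; simpa using hy, fun h => ⟨e p, h, by simp⟩⟩
  have hKpT : Kp ⊆ T := by
    intro p hp
    obtain ⟨x, hx, hxp⟩ := (hKpe p).1 hp
    show e p ∈ ψ.target
    rw [← hxp]
    exact ψ.map_source (hfψ hx)
  set V : EuclideanSpace ℝ (Fin (n + 1)) → ℝ := fun y => √(gramMatrix g ψ y).det * f (ψ.symm y)
    with hV
  have hVs : ContDiffOn ℝ ∞ V ψ.target := by
    refine (contDiffOn_sqrt_det_gramMatrix g hψ).mul ?_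
    rw [← contMDiffOn_iff_contDiffOn]
    exact hf.comp_contMDiffOn hsymm
  -- Extension by zero stays smooth because V ∘ e vanishes on T outside the compact set `Kp`, which
  -- lies in the open set T.
  set W : ℝ × (Fin n → ℝ) → ℝ := T.indicator (fun p => V (e p)) with hW
  have hWT : ∀ p ∈ T, W p = V (e p) := fun p hp => indicator_of_mem hp _
  have hW0 : ∀ p ∉ Kp, W p = 0 := by
    intro p hp
    by_cases hpT : p ∈ T
    · rw [hWT p hpT, hV]
      have : ψ.symm (e p) ∉ tsupport f := fun h =>
        hp ((hKpe p).2 ⟨_, h, ψ.right_inv hpT⟩)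
      simp [image_eq_zero_of_notMem_tsupport this]
    · exact indicator_of_notMem hpT _
  have hWs : ContDiff ℝ ∞ W := by
    rw [contDiff_iff_contDiffAt]
    intro p
    by_cases hp : p ∈ T
    · have h1 : ContDiffAt ℝ ∞ (fun p => V (e p)) p :=
        (hVs.contDiffAt (ψ.open_target.mem_nhds hp)).comp p (contDiff_splitCoord i).contDiffAt
      refine h1.congr_of_eventuallyEq ?_
      filter_upwards [hTo.mem_nhds hp] with q hq using hWT q hq
    · have hp' : p ∈ Kpᶜ := fun h => hp (hKpT h)
      refine (contDiffAt_const (c := (0 : ℝ))).congr_of_eventuallyEq ?_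
      filter_upwards [hKpc.isClosed.isOpen_compl.mem_nhds hp'] with q hq using hW0 q hq
  have hWc : HasCompactSupport W := HasCompactSupport.intro hKpc hW0
  have hWsupp : tsupport W ⊆ Kp := closure_minimal
    (fun p hp => by by_contra h; exact hp (hW0 p h)) hKpc.isClosed
  -- The shadow of D ∩ supp f in the other coordinates. It is compact, and as membership in D
  -- ignores the i-th coordinate, univ × B cuts out D wherever W can be nonzero.
  set B : Set (Fin n → ℝ) := Prod.snd '' (e.symm '' (ψ '' (D ∩ tsupport f))) with hB
  have hBc : IsCompact B := by
    refine IsCompact.image (IsCompact.image ?_ (continuous_splitCoord_symm i)) continuous_snd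
    exact (hfc.isCompact.inter_left hD.isClosed).image_of_continuousOn
      (ψ.continuousOn.mono fun x hx => hfψ hx.2)
  have hBD : ∀ p ∈ Kp, (ψ.symm (e p) ∈ D ↔ p.2 ∈ B) := by
    intro p hp
    have hpT : e p ∈ ψ.target := hKpT hp
    constructor
    · intro h
      obtain ⟨x, hx, hxp⟩ := (hKpe p).1 hp
      rw [← hxp, ψ.left_inv (hfψ hx)] at h
      exact ⟨p, ⟨e p, ⟨x, ⟨h, hx⟩, hxp⟩, by simp⟩, rfl⟩
    · rintro ⟨q, ⟨_, ⟨x, ⟨hxD, hxf⟩, rfl⟩, rfl⟩, hq⟩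
      refine (hprod x (hfψ hxf) _ (ψ.map_target hpT) fun j hj => ?_).1 hxD
      rw [ψ.right_inv hpT]
      obtain ⟨k, rfl⟩ := Fin.exists_succAbove_eq hj
      rw [he, splitCoord_apply_succAbove, ← hq]
      rfl
  refine ⟨W, B, hWs, hWc, hWsupp.trans hKpT, hBc, ?_⟩
  rintro Φ Φ' hΦ ⟨C, hC⟩ hΦ'
  -- Nothing is assumed about Φ' off T, where W vanishes; on T it is Φ in coordinates.
  have hmeas : AEStronglyMeasurable (fun p => W p * Φ' p) volume := by
    have h1 : (fun p => W p * Φ' p) =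
        T.indicator fun p => V (e p) * Φ (ψ.symm (e p)) := by
      funext p
      by_cases hp : p ∈ T
      · rw [indicator_of_mem hp, hWT p hp, hΦ' p hp]
      · rw [indicator_of_notMem hp, hW, indicator_of_notMem hp, zero_mul]
    rw [h1, aestronglyMeasurable_indicator_iff hTo.measurableSet]
    refine AEStronglyMeasurable.mul ?_ ?_
    · exact (hVs.continuousOn.comp hec.continuousOn fun p hp => hp).aestronglyMeasurable
        hTo.measurableSet
    · refine (hΦ.comp_aemeasurable ?_).aestronglyMeasurable
      exact (ψ.continuousOn_symm.comp hec.continuousOn fun p hp => hp).aemeasurable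
        hTo.measurableSet
  have hint : Integrable (fun p => W p * Φ' p) volume := by
    refine Integrable.mono' (g := fun p => ‖W p‖ * C)
      ((hWs.continuous.integrable_of_hasCompactSupport hWc).norm.mul_const C) hmeas
      (Eventually.of_forall fun p => ?_)
    by_cases hp : p ∈ Kp
    · rw [norm_mul]
      refine mul_le_mul_of_nonneg_left ?_ (norm_nonneg _)
      rw [← hΦ' p (hKpT hp)]
      obtain ⟨x, hx, hxp⟩ := (hKpe p).1 hp
      rw [← hxp, ψ.left_inv (hfψ hx)]
      exact hC x hx
    · simp [hW0 p hp]
  have hmu : (volume : Measure ℝ).prod ((volume : Measure (Fin n → ℝ)).restrict B) =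
      volume.restrict (univ ×ˢ B) := by
    rw [Measure.volume_eq_prod, ← Measure.prod_restrict, Measure.restrict_univ]
  rw [hmu]
  refine ⟨hint.restrict, ?_⟩
  have hDT := ψ.measurableSet_target_inter_preimage hD.measurableSet
  rw [setIntegral_riemannianVolume g hψ hD.measurableSet (f := fun x => f x * Φ x)
    (hf.continuous.measurable.mul hΦ)
    (fun x hx => by simp [image_eq_zero_of_notMem_tsupport fun h => hx (hfψ h)]),
    ← integral_indicator hDT, ← (measurePreserving_splitCoord i).integral_comp',
    ← integral_indicator (MeasurableSet.univ.prod hBc.measurableSet)]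
  congr 1
  funext p
  by_cases hp : p ∈ Kp
  · have hpT : e p ∈ ψ.target := hKpT hp
    by_cases hpD : ψ.symm (e p) ∈ D
    · rw [indicator_of_mem (show e p ∈ ψ.target ∩ ψ.symm ⁻¹' D from ⟨hpT, hpD⟩),
        indicator_of_mem (show p ∈ univ ×ˢ B from ⟨mem_univ _, (hBD p hp).1 hpD⟩), hWT p hpT,
        ← hΦ' p hpT, hV, mul_assoc]
    · rw [indicator_of_notMem fun h => hpD h.2,
        indicator_of_notMem fun h => hpD ((hBD p hp).2 h.2)]
  · have h1 : (univ ×ˢ B).indicator (fun p => W p * Φ' p) p = 0 := by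
      simp [Set.indicator, hW0 p hp]
    rw [h1, indicator_apply_eq_zero]
    intro hpT
    have := hWT p hpT.1
    rw [hW0 p hp] at this
    rw [← mul_assoc]
    exact mul_eq_zero_of_left this.symm _

end ChartIntegral

/-! ### Bounds for the cutoff and delta kernels -/

theorem measurable_heaviside : Measurable heaviside :=
  Measurable.ite measurableSet_Ici measurable_const measurable_const

theorem continuous_iteratedDeriv_mollifier {ρ : ℝ → ℝ} (hρ : ContDiff ℝ ∞ ρ) (j : ℕ) (η : ℝ) :
    Continuous (iteratedDeriv j (mollifier ρ η)) := by
  have := (hρ.iteratedDeriv_infty j).continuous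
  simp_rw [funext (iteratedDeriv_mollifier hρ j η)]
  fun_prop

theorem exists_iteratedDeriv_mollifier_eq_zero {ρ : ℝ → ℝ} (hρ : ContDiff ℝ ∞ ρ)
    (hc : HasCompactSupport ρ) (j : ℕ) :
    ∃ b : ℝ, 0 < b ∧ ∀ η > 0, ∀ t, b * η < |t| → iteratedDeriv j (mollifier ρ η) t = 0 := by
  obtain ⟨b, hb⟩ := (hc.iteratedDeriv' j).isCompact.isBounded.subset_closedBall (0 : ℝ)
  refine ⟨|b| + 1, by positivity, fun η hη t ht => ?_⟩
  rw [iteratedDeriv_mollifier hρ]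
  have : iteratedDeriv j ρ (η⁻¹ * t) = 0 := by
    by_contra hne
    have h1 := hb (subset_tsupport _ hne)
    rw [Metric.mem_closedBall, dist_zero_right, Real.norm_eq_abs, abs_mul,
      abs_of_pos (inv_pos.2 hη), inv_mul_le_iff₀ hη] at h1
    nlinarith [le_abs_self b]
  rw [this, mul_zero]

theorem abs_heaviside_sub_div_pow_le {ε : ℝ} (hε : 0 < ε) (d : ℕ) (t : ℝ) :
    |heaviside (t - ε) / t ^ d| ≤ (ε ^ d)⁻¹ := by
  unfold heaviside
  split_ifs with h
  · have ht : ε ≤ t := by linarith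
    rw [abs_of_nonneg (div_nonneg zero_le_one (pow_nonneg (hε.le.trans ht) d)), one_div]
    gcongr
  · simp only [zero_div, abs_zero]
    positivity

/-! ### Transverse densities: additivity and the region off the zero locus -/

section TransverseDensity

variable {d : ℕ} {M : Type*} [TopologicalSpace M] [ChartedSpace (EuclideanSpace ℝ (Fin d)) M]
  [MeasurableSpace M]

/-- The push-forward of `f dμ|_D` under `u` has, near zero, a smooth density `h`: it computes the
integrals of the derivatives of delta functions (of all positive multiples of `u`), and the
regulated integrals of `u^(-d)`. -/
def HasTransverseDensity (d : ℕ) {M : Type*} [TopologicalSpace M]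
    [ChartedSpace (EuclideanSpace ℝ (Fin d)) M] [MeasurableSpace M] (μ : Measure M) (D : Set M)
    (u f : M → ℝ) : Prop :=
  ∃ h : ℝ → ℝ, ContDiff ℝ ∞ h ∧ HasCompactSupport h ∧
    (∀ κ : M → ℝ, ContMDiff (𝓡 d) 𝓘(ℝ, ℝ) ∞ κ → (∀ x, 0 < κ x) → ∀ ρ : ℝ → ℝ, ContDiff ℝ ∞ ρ →
      HasCompactSupport ρ → ∫ t, ρ t = 1 → ∀ j : ℕ,
      Tendsto (fun η : ℝ => ∫ x in D,
          f x * (κ x ^ (j + 1) * iteratedDeriv j (mollifier ρ η) (κ x * u x)) ∂μ)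
        (𝓝[>] 0) (𝓝 ((-1) ^ j * iteratedDeriv j h 0))) ∧
    ∃ C t₀ : ℝ, 0 < t₀ ∧ ∀ ε : ℝ, 0 < ε → ε < t₀ →
      ∫ x in D, f x * (heaviside (u x - ε) / u x ^ d) ∂μ = C + ∫ t in Ioi ε, h t / t ^ d

theorem Continuous.integrableOn_mul_of_bounded [BorelSpace M] [T2Space M] {μ : Measure M}
    [IsFiniteMeasureOnCompacts μ] {D : Set M} (hD : IsCompact D) {f Φ : M → ℝ} (hf : Continuous f)
    (hΦ : Measurable Φ) {C : ℝ} (hC : ∀ x ∈ D, |Φ x| ≤ C) :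
    IntegrableOn (fun x => f x * Φ x) D μ := by
  refine (hf.continuousOn.integrableOn_compact hD).mul_bdd (c := C)
    hΦ.aestronglyMeasurable ?_
  filter_upwards [ae_restrict_mem hD.measurableSet] with x hx using hC x hx

theorem Continuous.integrableOn_mul [BorelSpace M] [T2Space M] {μ : Measure M}
    [IsFiniteMeasureOnCompacts μ] {D : Set M} (hD : IsCompact D) {f Φ : M → ℝ} (hf : Continuous f)
    (hΦ : Continuous Φ) : IntegrableOn (fun x => f x * Φ x) D μ :=
  (hf.mul hΦ).continuousOn.integrableOn_compact hD

theorem HasTransverseDensity.zero (μ : Measure M) (D : Set M) (u : M → ℝ) :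
    HasTransverseDensity d μ D u (fun _ => 0) := by
  refine ⟨fun _ => 0, contDiff_const, HasCompactSupport.zero, ?_, 0, 1, one_pos, ?_⟩
  · intro κ _ _ ρ _ _ _ j
    simp
  · intro ε _ _
    simp

theorem HasTransverseDensity.add [BorelSpace M] [T2Space M] {μ : Measure M}
    [IsFiniteMeasureOnCompacts μ] {D : Set M} (hD : IsCompact D) {u f₁ f₂ : M → ℝ}
    (hu : Continuous u) (hf₁ : Continuous f₁) (hf₂ : Continuous f₂)
    (h₁ : HasTransverseDensity d μ D u f₁) (h₂ : HasTransverseDensity d μ D u f₂) :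
    HasTransverseDensity d μ D u (fun x => f₁ x + f₂ x) := by
  obtain ⟨h, hh, hhc, hδ, C, t, ht, hv⟩ := h₁
  obtain ⟨h', hh', hhc', hδ', C', t', ht', hv'⟩ := h₂
  refine ⟨h + h', hh.add hh', hhc.add hhc', ?_, C + C', min t t', lt_min ht ht', ?_⟩
  · intro κ hκ hκ0 ρ hρ hρc hρ1 j
    rw [iteratedDeriv_add (hh.contDiffAt.of_le (by exact_mod_cast le_top))
      (hh'.contDiffAt.of_le (by exact_mod_cast le_top)), mul_add]
    refine ((hδ κ hκ hκ0 ρ hρ hρc hρ1 j).add (hδ' κ hκ hκ0 ρ hρ hρc hρ1 j)).congr fun η => ?_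
    have hc := continuous_iteratedDeriv_mollifier hρ j η
    have hκc := hκ.continuous
    rw [← integral_add (hf₁.integrableOn_mul hD (by fun_prop))
      (hf₂.integrableOn_mul hD (by fun_prop))]
    simp_rw [add_mul]
  · intro ε hε hεt
    have hm : Measurable fun x => heaviside (u x - ε) / u x ^ d :=
      (measurable_heaviside.comp (hu.measurable.sub_const ε)).div (hu.measurable.pow_const d)
    have hb : ∀ x ∈ D, |heaviside (u x - ε) / u x ^ d| ≤ (ε ^ d)⁻¹ := fun x _ =>
      abs_heaviside_sub_div_pow_le hε d (u x)
    have hcont : ∀ {k : ℝ → ℝ}, ContDiff ℝ ∞ k → HasCompactSupport k →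
        IntegrableOn (fun t => k t / t ^ d) (Ioi ε) := by
      intro k hk hkc
      have hi : Integrable k := hk.continuous.integrable_of_hasCompactSupport hkc
      simp_rw [div_eq_mul_inv]
      refine hi.integrableOn.mul_bdd (c := (ε ^ d)⁻¹) (by fun_prop) ?_
      filter_upwards [ae_restrict_mem measurableSet_Ioi] with s hs
      have hs' : ε < s := hs
      rw [norm_inv, norm_pow, Real.norm_eq_abs, abs_of_pos (hε.trans hs')]
      gcongr
    simp_rw [add_mul]
    rw [integral_add (hf₁.integrableOn_mul_of_bounded hD hm hb)
      (hf₂.integrableOn_mul_of_bounded hD hm hb), hv ε hε (hεt.trans_le (min_le_left _ _)),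
      hv' ε hε (hεt.trans_le (min_le_right _ _))]
    simp_rw [Pi.add_apply, add_div]
    rw [integral_add (hcont hh hhc) (hcont hh' hhc')]
    ring

theorem HasTransverseDensity.sum [BorelSpace M] [T2Space M] {μ : Measure M}
    [IsFiniteMeasureOnCompacts μ] {D : Set M} (hD : IsCompact D) {u : M → ℝ} (hu : Continuous u)
    {ι : Type*} (s : Finset ι) {f : ι → M → ℝ} (hf : ∀ k ∈ s, Continuous (f k))
    (h : ∀ k ∈ s, HasTransverseDensity d μ D u (f k)) :
    HasTransverseDensity d μ D u (fun x => ∑ k ∈ s, f k x) := by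
  classical
  induction s using Finset.induction_on with
  | empty => simpa using HasTransverseDensity.zero μ D u
  | insert a s ha ih =>
    simp_rw [Finset.sum_insert ha]
    refine HasTransverseDensity.add hD hu (hf a (Finset.mem_insert_self a s))
      (continuous_finsetSum _ fun k hk => hf k (Finset.mem_insert_of_mem hk))
      (h a (Finset.mem_insert_self a s))
      (ih (fun k hk => hf k (Finset.mem_insert_of_mem hk))
        fun k hk => h k (Finset.mem_insert_of_mem hk))

theorem HasTransverseDensity.congr [BorelSpace M] [T2Space M] {μ : Measure M} {D : Set M}
    (hD : IsCompact D) {u f f' : M → ℝ} (hff' : ∀ x ∈ D, f x = f' x)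
    (h : HasTransverseDensity d μ D u f) : HasTransverseDensity d μ D u f' := by
  obtain ⟨h, hh, hhc, hδ, C, t, ht, hv⟩ := h
  have hcongr : ∀ Φ : M → ℝ, ∫ x in D, f x * Φ x ∂μ = ∫ x in D, f' x * Φ x ∂μ := fun Φ =>
    setIntegral_congr_fun hD.measurableSet fun x hx => by simp only [hff' x hx]
  simp_rw [hcongr] at hδ hv
  exact ⟨h, hh, hhc, hδ, C, t, ht, hv⟩

/-- Away from the zero locus of `u` the transverse density vanishes. -/
theorem HasTransverseDensity.of_ne_zero [BorelSpace M] [T2Space M] {μ : Measure M} {D : Set M}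
    (hD : IsCompact D) {u f : M → ℝ} (hu : Continuous u)
    (hne : ∀ x ∈ D, x ∈ tsupport f → u x ≠ 0) : HasTransverseDensity d μ D u f := by
  have hK : IsCompact (D ∩ tsupport f) := hD.inter_right (isClosed_tsupport f)
  have hpos : ∀ k : M → ℝ, Continuous k → (∀ x ∈ D ∩ tsupport f, 0 < k x) →
      ∃ c : ℝ, 0 < c ∧ ∀ x ∈ D ∩ tsupport f, c ≤ k x := by
    intro k hk hk0
    rcases (D ∩ tsupport f).eq_empty_or_nonempty with he | hne
    · exact ⟨1, one_pos, by simp [he]⟩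
    · obtain ⟨p, hp, hmin⟩ := hK.exists_isMinOn hne hk.continuousOn
      exact ⟨k p, hk0 p hp, fun q hq => hmin hq⟩
  refine ⟨fun _ => 0, contDiff_const, HasCompactSupport.zero, ?_, ?_⟩
  · intro κ hκ hκ0 ρ hρ hρc _ j
    obtain ⟨c, hc0, hc⟩ := hpos (fun x => |κ x * u x|) (hκ.continuous.mul hu).abs
      fun x hx => abs_pos.2 (mul_ne_zero (hκ0 x).ne' (hne x hx.1 hx.2))
    obtain ⟨b, hb0, hb⟩ := exists_iteratedDeriv_mollifier_eq_zero hρ hρc j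
    simp only [iteratedDeriv_fun_const_zero, mul_zero]
    -- On D ∩ supp f, |κu| ≥ c > 0, so once bη < c the delta sequence vanishes there.
    refine tendsto_const_nhds.congr' ?_
    filter_upwards [Ioo_mem_nhdsGT (div_pos hc0 hb0)] with η hη
    refine (setIntegral_eq_zero_of_forall_eq_zero fun x hx => ?_).symm
    by_cases hxf : x ∈ tsupport f
    · have h1 : b * η < c := by
        have := hη.2
        rwa [lt_div_iff₀ hb0, mul_comm] at this
      rw [hb η hη.1 _ (h1.trans_le (hc x ⟨hx, hxf⟩)), mul_zero, mul_zero]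
    · rw [image_eq_zero_of_notMem_tsupport hxf, zero_mul]
  · obtain ⟨c, hc0, hc⟩ := hpos (fun x => |u x|) hu.abs
      fun x hx => abs_pos.2 (hne x hx.1 hx.2)
    -- Since |u| ≥ c on D ∩ supp f, a cutoff at ε < c selects the same points as the cutoff at 0:
    -- the regulated integral is constant.
    refine ⟨∫ x in D, f x * (heaviside (u x) / u x ^ d) ∂μ, c, hc0, fun ε hε hεc => ?_⟩
    simp only [zero_div, integral_zero, add_zero]
    refine setIntegral_congr_fun hD.measurableSet fun x hx => ?_
    by_cases hxf : x ∈ tsupport f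
    · have h1 := hc x ⟨hx, hxf⟩
      have h2 : heaviside (u x - ε) = heaviside (u x) := by
        unfold heaviside
        rcases le_or_gt 0 (u x) with h0 | h0
        · rw [abs_of_nonneg h0] at h1
          rw [if_pos h0, if_pos (by linarith)]
        · rw [if_neg (by linarith), if_neg (by linarith)]
      simp only [h2]
    · simp only [image_eq_zero_of_notMem_tsupport hxf, zero_mul]

end TransverseDensity

/-! ### The transverse density in a straightened chart -/

section Chart

variable {n : ℕ} {M : Type*} [TopologicalSpace M] [T2Space M]
  [ChartedSpace (EuclideanSpace ℝ (Fin (n + 1))) M] [IsManifold (𝓡 (n + 1)) ∞ M]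
  [MeasurableSpace M] [BorelSpace M]

/-- Existence of the transverse density in a chart one of whose coordinates is `u`. -/
theorem HasTransverseDensity.of_chart (g : SmoothMetric (n + 1) M)
    {ψ : OpenPartialHomeomorph M (EuclideanSpace ℝ (Fin (n + 1)))}
    (hψ : ψ ∈ IsManifold.maximalAtlas (𝓡 (n + 1)) ∞ M) (i : Fin (n + 1)) {D : Set M}
    (hD : IsCompact D)
    (hprod : ∀ x ∈ ψ.source, ∀ y ∈ ψ.source, (∀ j, j ≠ i → ψ x j = ψ y j) → (x ∈ D ↔ y ∈ D))
    {u : M → ℝ} (hu : Continuous u) (hψu : ∀ x ∈ ψ.source, ψ x i = u x)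
    {f : M → ℝ} (hf : ContMDiff (𝓡 (n + 1)) 𝓘(ℝ, ℝ) ∞ f) (hfc : HasCompactSupport f)
    (hfψ : tsupport f ⊆ ψ.source) :
    HasTransverseDensity (n + 1) (riemannianVolume g) D u f := by
  obtain ⟨W, B, hW, hWc, hWT, hB, key⟩ := exists_weight_setIntegral g hψ i hD hprod hf hfc hfψ
  set T := splitCoord i ⁻¹' ψ.target with hT
  have hTo : IsOpen T := ψ.open_target.preimage (contDiff_splitCoord i).continuous
  have huT : ∀ p ∈ T, u (ψ.symm (splitCoord i p)) = p.1 := by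
    intro p hp
    rw [← hψu _ (ψ.map_target hp), ψ.right_inv hp, splitCoord_apply_same]
  -- The density is the fibre integral over B. The volume identity holds here for all ε > 0 without
  -- a constant, so 0 and 1 are default values.
  refine ⟨fun t => ∫ y in B, W (t, y), contDiff_setIntegral_of_contDiff hB hW, ?_, ?_, 0, 1,
    one_pos, ?_⟩
  · refine HasCompactSupport.intro (hWc.isCompact.image continuous_fst) fun t ht => ?_
    refine integral_eq_zero_of_ae (Eventually.of_forall fun y => ?_)
    exact image_eq_zero_of_notMem_tsupport fun h => ht ⟨_, h, rfl⟩
  · intro κ hκ hκ0 ρ hρ hρc hρ1 j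
    have hκT : ContDiffOn ℝ ∞ (fun p => κ (ψ.symm (splitCoord i p))) T := by
      have h1 : ContDiffOn ℝ ∞ (κ ∘ ψ.symm) ψ.target := by
        rw [← contMDiffOn_iff_contDiffOn]
        exact hκ.comp_contMDiffOn (contMDiffOn_symm_of_mem_maximalAtlas hψ)
      exact h1.comp (contDiff_splitCoord i).contDiffOn fun p hp => hp
    refine (tendsto_integral_iteratedDeriv_mollifier hW hWc hB hTo hWT hκT
      (fun p _ => hκ0 _) hρ hρc hρ1 j).congr fun η => ?_
    have hc := continuous_iteratedDeriv_mollifier hρ j η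
    have hκc := hκ.continuous
    have hΦ : Continuous fun x => κ x ^ (j + 1) * iteratedDeriv j (mollifier ρ η) (κ x * u x) := by
      fun_prop
    obtain ⟨hint, heq⟩ := key _ (fun p => κ (ψ.symm (splitCoord i p)) ^ (j + 1) *
      iteratedDeriv j (mollifier ρ η) (κ (ψ.symm (splitCoord i p)) * p.1)) hΦ.measurable
      (by simpa using hfc.isCompact.exists_bound_of_continuousOn hΦ.continuousOn)
      (fun p hp => by simp only [huT p hp])
    rw [heq, integral_prod_symm _ hint]
    simp only [mul_assoc]
  · intro ε hε _
    have hm : Measurable fun x => heaviside (u x - ε) / u x ^ (n + 1) :=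
      (measurable_heaviside.comp (hu.measurable.sub_const ε)).div (hu.measurable.pow_const _)
    obtain ⟨hint, heq⟩ := key _ (fun p => heaviside (p.1 - ε) / p.1 ^ (n + 1)) hm
      ⟨_, fun x _ => abs_heaviside_sub_div_pow_le hε (n + 1) (u x)⟩
      (fun p hp => by simp only [huT p hp])
    -- The convention θ(0) = 1 gives the closed half-line, which differs from the open one by a null
    -- set.
    rw [heq, integral_prod _ hint, zero_add, ← integral_Ici_eq_integral_Ioi,
      ← integral_indicator measurableSet_Ici]
    congr 1
    funext t
    simp only [integral_mul_const]
    by_cases ht : ε ≤ t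
    · rw [indicator_of_mem (show t ∈ Ici ε from ht), heaviside, if_pos (by linarith)]
      ring
    · rw [indicator_of_notMem (show t ∉ Ici ε from ht), heaviside,
        if_neg (by linarith [not_le.1 ht])]
      simp

end Chart

/-! ### Gluing the transverse density over the region -/

section Global

variable {d : ℕ} {M : Type*} [TopologicalSpace M] [ChartedSpace (EuclideanSpace ℝ (Fin d)) M]

/-- The product rule for s = (s/τ)·τ at a zero of s gives ds = τ d(s/τ). -/
theorem mfderiv_div_ne_zero {s τ : M → ℝ} (hs : ContMDiff (𝓡 d) 𝓘(ℝ, ℝ) ∞ s)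
    (hτ : ContMDiff (𝓡 d) 𝓘(ℝ, ℝ) ∞ τ) (hτ0 : ∀ x, 0 < τ x) {p : M} (hp : s p = 0)
    (hds : mfderiv (𝓡 d) 𝓘(ℝ, ℝ) s p ≠ 0) :
    mfderiv (𝓡 d) 𝓘(ℝ, ℝ) (fun x => s x / τ x) p ≠ 0 := by
  intro h
  have hu : ContMDiff (𝓡 d) 𝓘(ℝ, ℝ) ∞ fun x => s x / τ x := hs.div₀ hτ fun x => (hτ0 x).ne'
  have h1 := ((hu.mdifferentiable (by simp)) p).hasMFDerivAt.mul
    ((hτ.mdifferentiable (by simp)) p).hasMFDerivAt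
  have h2 : (fun x => s x / τ x) * τ = s := by
    funext x
    exact div_mul_cancel₀ _ (hτ0 x).ne'
  rw [h2, h, hp] at h1
  have hzero : ∀ L : EuclideanSpace ℝ (Fin d) →L[ℝ] ℝ, (0 / τ p) • L + τ p • 0 = 0 := fun L => by
    rw [zero_div, zero_smul, smul_zero, add_zero]
  exact hds (h1.mfderiv.trans (hzero _))

variable [T2Space M] [IsManifold (𝓡 d) ∞ M] [MeasurableSpace M] [BorelSpace M]

theorem HasTransverseDensity.exists_nhds_of_mem (hd : 1 ≤ d) (g : SmoothMetric d M) {D S : Set M}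
    (hD : IsCompact D) (hcollar : IsCollaredAlong d D S) {u : M → ℝ}
    (hu : ContMDiff (𝓡 d) 𝓘(ℝ, ℝ) ∞ u) (hS : ∀ x, u x = 0 ↔ x ∈ S)
    (hdu : ∀ x ∈ S, mfderiv (𝓡 d) 𝓘(ℝ, ℝ) u x ≠ 0) {p : M} (hp : p ∈ D) :
    ∃ U : Set M, IsOpen U ∧ p ∈ U ∧ ∀ f : M → ℝ, ContMDiff (𝓡 d) 𝓘(ℝ, ℝ) ∞ f → tsupport f ⊆ U →
      HasTransverseDensity d (riemannianVolume g) D u f := by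
  by_cases hpS : p ∈ S
  · obtain ⟨φ, hφ, i, hpφ, hSφ, hDφ⟩ := hcollar p ⟨hp, hpS⟩
    obtain ⟨ψ, hψ, hpψ, hψφ, hψc⟩ := exists_straightened_chart hu hφ hpφ (hdu p hpS)
      (fun x hx h => (hS x).2 ((hSφ x hx).2 h)) ((hSφ p hpφ).1 hpS)
    have : LocallyCompactSpace M := ChartedSpace.locallyCompactSpace (EuclideanSpace ℝ (Fin d)) M
    obtain ⟨K, hK, hpK, hKψ⟩ := exists_compact_subset ψ.open_source hpψ
    -- Supports inside the compact K are compact. The straightened chart keeps the coordinates j ≠ i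
    -- of the collar chart, so D is still a product in it.
    refine ⟨interior K, isOpen_interior, hpK, fun f hf hfK => ?_⟩
    have hfK' := hfK.trans interior_subset
    obtain ⟨n, rfl⟩ : ∃ n, d = n + 1 := ⟨d - 1, by omega⟩
    refine HasTransverseDensity.of_chart g hψ i hD (fun x hx y hy hxy => ?_) hu.continuous
      (fun x hx => (hψc x hx).1) hf (hK.of_isClosed_subset (isClosed_tsupport f) hfK')
      (hfK'.trans hKψ)
    refine hDφ x (hψφ hx) y (hψφ hy) fun j hj => ?_
    rw [← (hψc x hx).2 j hj, ← (hψc y hy).2 j hj, hxy j hj]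
  · refine ⟨{x | u x ≠ 0}, isOpen_ne_fun hu.continuous continuous_const,
      fun h => hpS ((hS p).1 h), fun f _ hfU => ?_⟩
    exact HasTransverseDensity.of_ne_zero hD hu.continuous fun x _ hx => hfU hx

/-- Existence of the transverse density for a collared compact region. -/
theorem HasTransverseDensity.of_isCollaredAlong [SecondCountableTopology M] (hd : 1 ≤ d)
    (g : SmoothMetric d M) {D S : Set M} (hD : IsCompact D) (hcollar : IsCollaredAlong d D S)
    {u : M → ℝ} (hu : ContMDiff (𝓡 d) 𝓘(ℝ, ℝ) ∞ u) (hS : ∀ x, u x = 0 ↔ x ∈ S)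
    (hdu : ∀ x ∈ S, mfderiv (𝓡 d) 𝓘(ℝ, ℝ) u x ≠ 0) {f : M → ℝ}
    (hf : ContMDiff (𝓡 d) 𝓘(ℝ, ℝ) ∞ f) :
    HasTransverseDensity d (riemannianVolume g) D u f := by
  have : LocallyCompactSpace M := ChartedSpace.locallyCompactSpace (EuclideanSpace ℝ (Fin d)) M
  choose U hUo hpU hU using fun p : D =>
    HasTransverseDensity.exists_nhds_of_mem hd g hD hcollar hu hS hdu p.2
  -- Only finitely many members meet the compact D, and only values on D enter, so a finite sum
  -- suffices.
  obtain ⟨χ, hχ⟩ := SmoothPartitionOfUnity.exists_isSubordinate (𝓡 d) hD.isClosed U hUo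
    fun p hp => mem_iUnion.2 ⟨⟨p, hp⟩, hpU ⟨p, hp⟩⟩
  have hfin := χ.locallyFinite.finite_nonempty_inter_compact hD
  have hχf : ∀ k, ContMDiff (𝓡 d) 𝓘(ℝ, ℝ) ∞ fun x => χ k x * f x := fun k =>
    (χ k).contMDiff.mul hf
  refine (HasTransverseDensity.sum hD hu.continuous hfin.toFinset
    (f := fun k x => χ k x * f x) (fun k _ => (hχf k).continuous)
    fun k _ => hU k _ (hχf k) ((tsupport_mul_subset_left (f := χ k)).trans (hχ k))).congr hD ?_
  intro x hx
  rw [← Finset.sum_mul]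
  have h1 : ∑ k ∈ hfin.toFinset, χ k x = 1 := by
    rw [← χ.sum_eq_one hx]
    refine (finsum_eq_sum_of_support_subset _ fun k hk => ?_).symm
    simpa using ⟨x, hk, hx⟩
  rw [h1, one_mul]

end Global

/-! ### Conformal invariance -/

section Conformal

variable {d : ℕ} {M : Type*} [TopologicalSpace M]
  [ChartedSpace (EuclideanSpace ℝ (Fin d)) M] [IsManifold (𝓡 d) ∞ M]
  {c : ConformalStructure d M}

theorem ConformalStructure.exists_reference (c : ConformalStructure d M) :
    ∃ g₀ : c.metrics, ∀ g : c.metrics, ∃ Ω : M → ℝ, IsRescaling g₀.1 g.1 Ω := by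
  obtain ⟨g₀, hg₀⟩ := c.exists_eq
  have hmem : g₀ ∈ c.metrics := by
    rw [hg₀]
    exact ⟨fun _ => 1, contMDiff_const, fun _ => one_pos, by simp⟩
  exact ⟨⟨g₀, hmem⟩, fun g => (Set.ext_iff.1 hg₀ g.1).1 g.2⟩

variable [MeasurableSpace M]

theorem exists_contDiff_hasCompactSupport_integral_eq_one :
    ∃ ρ : ℝ → ℝ, ContDiff ℝ ∞ ρ ∧ HasCompactSupport ρ ∧ ∫ t, ρ t = 1 := by
  let b : ContDiffBump (0 : ℝ) := default
  exact ⟨b.normed volume, b.contDiff_normed, b.hasCompactSupport_normed, b.integral_normed⟩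

/-- The class contains a metric and a test function of integral one exists, so the defining
condition is not vacuous and limits are unique. -/
theorem HasDeltaIntegral.unique {w : ℝ} {σ : ConformalDensity c 1} {j : ℕ}
    {f : ConformalDensity c w} {D : Set M} {L L' : ℝ} (h : HasDeltaIntegral σ j f D L)
    (h' : HasDeltaIntegral σ j f D L') : L = L' := by
  obtain ⟨g₀, -⟩ := c.exists_reference
  obtain ⟨ρ, hρ, hρc, hρ1⟩ := exists_contDiff_hasCompactSupport_integral_eq_one
  exact tendsto_nhds_unique (h g₀ ρ hρ hρc hρ1) (h' g₀ ρ hρ hρc hρ1)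

variable [T2Space M] [BorelSpace M]

/-- The integrand is the continuous function τ^(-d) times θ(u-ε)/u^d, which is bounded by ε^(-d). -/
theorem ConformalDensity.integrableOn_regulatedIntegrand (σ : ConformalDensity c 1)
    {τ : ConformalDensity c 1} (hτ : τ.IsTrueScale) {D : Set M} (hD : IsCompact D) (g : c.metrics)
    {ε : ℝ} (hε : 0 < ε) :
    IntegrableOn (regulatedIntegrand σ τ g ε) D (riemannianVolume g.1) := by
  have hτc := (τ.smooth g).continuous
  have hu : Continuous fun x => σ.rep g x / τ.rep g x :=
    (σ.smooth g).continuous.div hτc fun x => (hτ g x).ne'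
  have hm : Measurable fun x =>
      heaviside (σ.rep g x / τ.rep g x - ε) / (σ.rep g x / τ.rep g x) ^ d :=
    (measurable_heaviside.comp (hu.measurable.sub_const ε)).div (hu.measurable.pow_const d)
  refine ((hτc.pow d).inv₀ fun x => (pow_pos (hτ g x) d).ne').integrableOn_mul_of_bounded hD hm
    (fun x _ => abs_heaviside_sub_div_pow_le hε d _) |>.congr ?_
  refine Eventually.of_forall fun x => ?_
  have := (hτ g x).ne'
  simp only [regulatedIntegrand, Pi.inv_apply, Pi.pow_apply, div_pow]
  field_simp

variable [SecondCountableTopology M]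

/-- Delta integrals of densities of weight `-k`, computed in a reference metric in terms of the
defining function `σ / τ`. -/
theorem ConformalDensity.hasDeltaIntegral_of_transverseDensity {σ : ConformalDensity c 1}
    {D : Set M} (hD : IsCompact D) {g₀ : c.metrics}
    (hg₀ : ∀ g : c.metrics, ∃ Ω : M → ℝ, IsRescaling g₀.1 g.1 Ω) {τ : M → ℝ}
    (hτ : ContMDiff (𝓡 d) 𝓘(ℝ, ℝ) ∞ τ) (hτ0 : ∀ x, 0 < τ x) {h : ℝ → ℝ}
    (hh : ∀ κ : M → ℝ, ContMDiff (𝓡 d) 𝓘(ℝ, ℝ) ∞ κ → (∀ x, 0 < κ x) → ∀ ρ : ℝ → ℝ,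
      ContDiff ℝ ∞ ρ → HasCompactSupport ρ → ∫ t, ρ t = 1 → ∀ j : ℕ,
      Tendsto (fun η : ℝ => ∫ x in D, (τ x ^ d)⁻¹ *
          (κ x ^ (j + 1) * iteratedDeriv j (mollifier ρ η) (κ x * (σ.rep g₀ x / τ x)))
          ∂(riemannianVolume g₀.1))
        (𝓝[>] 0) (𝓝 ((-1) ^ j * iteratedDeriv j h 0)))
    {w : ℝ} {k : ℕ} (hk : k < d) (hw : w = -(k : ℝ)) (f : ConformalDensity c w)
    (hf : ∀ x, f.rep g₀ x = 1 / τ x ^ k) :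
    HasDeltaIntegral σ (d - 1 - k) f D ((-1) ^ (d - 1 - k) * iteratedDeriv (d - 1 - k) h 0) := by
  intro g ρ hρ hρc hρ1
  obtain ⟨Ω, hΩ⟩ := hg₀ g
  -- With κ = Ωτ and j + 1 = d - k: κ·(σ/τ) = Ωσ represents σ in the metric g, and τ^(-d) κ^(d-k) =
  -- Ω^d (Ωτ)^(-k) is the volume factor times the density.
  refine (hh (fun x => Ω x * τ x) (hΩ.1.mul hτ) (fun x => mul_pos (hΩ.2.1 x) (hτ0 x)) ρ hρ hρc
    hρ1 (d - 1 - k)).congr fun η => ?_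
  rw [setIntegral_riemannianVolume_rescale hΩ hD.measurableSet]
  congr 1
  funext x
  have hΩx := hΩ.2.1 x
  have hτx := hτ0 x
  obtain ⟨m, rfl⟩ : ∃ m, d = m + k + 1 := ⟨d - 1 - k, by omega⟩
  rw [f.rescale g₀ g Ω hΩ x, σ.rescale g₀ g Ω hΩ x, hf, hw, Real.rpow_neg hΩx.le,
    Real.rpow_natCast, Real.rpow_one, show m + k + 1 - 1 - k = m by omega,
    show Ω x * τ x * (σ.rep g₀ x / τ x) = Ω x * σ.rep g₀ x by field_simp]
  have hpow : ∀ y : ℝ, y ^ (m + k + 1) = y ^ (m + 1) * y ^ k := fun y => by ring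
  rw [hpow, hpow, mul_pow]
  field_simp

/-- The factor Ω^d of the volume cancels the one in σ^(-d), and σ/τ is invariant. -/
theorem ConformalDensity.regulatedVolume_eq (σ : ConformalDensity c 1)
    {τ : ConformalDensity c 1} (hτ : τ.IsTrueScale) {D : Set M} (hD : IsCompact D)
    {g₀ g : c.metrics} {Ω : M → ℝ} (hΩ : IsRescaling g₀.1 g.1 Ω) (ε : ℝ) :
    regulatedVolume σ τ D g ε = ∫ x in D, (τ.rep g₀ x ^ d)⁻¹ *
      (heaviside (σ.rep g₀ x / τ.rep g₀ x - ε) / (σ.rep g₀ x / τ.rep g₀ x) ^ d)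
        ∂(riemannianVolume g₀.1) := by
  rw [regulatedVolume, setIntegral_riemannianVolume_rescale hΩ hD.measurableSet]
  congr 1
  funext x
  have hΩx := (hΩ.2.1 x).ne'
  have hτx := (hτ g₀ x).ne'
  rw [regulatedIntegrand, σ.rescale g₀ g Ω hΩ x, τ.rescale g₀ g Ω hΩ x, Real.rpow_one,
    mul_div_mul_left _ _ hΩx, mul_pow, div_pow]
  field_simp

end Conformal

end

/-! ### The volume expansion -/

theorem theorem3p1 {d : ℕ} (hd : 1 ≤ d) {M : Type*} [TopologicalSpace M] [T2Space M]
    [SecondCountableTopology M] [ChartedSpace (EuclideanSpace ℝ (Fin d)) M]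
    [IsManifold (𝓡 d) ∞ M] [MeasurableSpace M] [BorelSpace M]
    (c : ConformalStructure d M) (S : Set M) (σ : ConformalDensity c 1)
    (hσ : σ.IsDefiningDensity S)
    (D : Set M) (hD : IsCompact D) (hcollar : IsCollaredAlong d D S) :
    ∃ A : ℝ,
      (∃ a : ℝ, HasDeltaIntegral σ (d - 1) (ConformalDensity.unit c) D a ∧
        A = (-1) ^ d / (Nat.factorial (d - 1) : ℝ) * a) ∧
      ∀ (τ : ConformalDensity c 1) (hτ : τ.IsTrueScale),
        ∃ (v : ℕ → ℝ) (volRen : ℝ) (R : ℝ → ℝ),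
          (∀ k ∈ Finset.Icc 1 (d - 1), ∃ b : ℝ,
            HasDeltaIntegral σ (d - 1 - k) (τ.invPow hτ k) D b ∧
            v k = (-1) ^ (d - k - 1) / ((Nat.factorial (d - 1 - k) : ℝ) * (k : ℝ)) * b) ∧
          ContDiff ℝ ∞ R ∧
          (∀ (g : c.metrics) (ε : ℝ), 0 < ε →
            IntegrableOn (regulatedIntegrand σ τ g ε) D (riemannianVolume g.1)) ∧
          ∃ ε₀ : ℝ, 0 < ε₀ ∧ ∀ (g : c.metrics) (ε : ℝ), 0 < ε → ε < ε₀ →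
            regulatedVolume σ τ D g ε =
              (∑ k ∈ Finset.Icc 1 (d - 1), v k * (ε ^ k)⁻¹) + A * Real.log ε + volRen
                + ε * R ε := by
  obtain ⟨g₀, hg₀⟩ := c.exists_reference
  have hdens : ∀ τ : M → ℝ, ContMDiff (𝓡 d) 𝓘(ℝ, ℝ) ∞ τ → (∀ x, 0 < τ x) →
      HasTransverseDensity d (riemannianVolume g₀.1) D (fun x => σ.rep g₀ x / τ x)
        (fun x => (τ x ^ d)⁻¹) := by
    intro τ hτ hτ0
    have hτne : ∀ x, τ x ≠ 0 := fun x => (hτ0 x).ne'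
    refine HasTransverseDensity.of_isCollaredAlong (S := S) hd g₀.1 hD hcollar
      ((σ.smooth g₀).div₀ hτ hτne) (fun x => ?_) (fun x hx => ?_)
      ((hτ.pow d).inv₀ fun x => pow_ne_zero d (hτne x))
    · change σ.rep g₀ x / τ x = 0 ↔ x ∈ S
      rw [div_eq_zero_iff, or_iff_left (hτne x), (hσ g₀).1 x]
    · exact mfderiv_div_ne_zero (σ.smooth g₀) hτ hτ0 (((hσ g₀).1 x).2 hx) ((hσ g₀).2 x hx)
  have hunit : ∀ {τ : M → ℝ} (x : M), (ConformalDensity.unit c).rep g₀ x = 1 / τ x ^ 0 :=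
    fun x => by simp [ConformalDensity.unit]
  -- The anomaly must be fixed before τ is given, so it is computed with the constant function 1 in
  -- the reference metric.
  obtain ⟨h₁, -, -, hδ₁, -⟩ := hdens (fun _ => 1) contMDiff_const fun _ => one_pos
  have ha := ConformalDensity.hasDeltaIntegral_of_transverseDensity hD hg₀ contMDiff_const
    (fun _ => one_pos) hδ₁ (k := 0) hd (by simp) (ConformalDensity.unit c) hunit
  refine ⟨_, ⟨_, ha, rfl⟩, fun τ hτ => ?_⟩
  obtain ⟨h, hh, hhc, hδ, C, t₀, ht₀, hvol⟩ := hdens (τ.rep g₀) (τ.smooth g₀) (hτ g₀)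
  have hb := fun {w : ℝ} {k : ℕ} => ConformalDensity.hasDeltaIntegral_of_transverseDensity
    (w := w) (k := k) hD hg₀ (τ.smooth g₀) (hτ g₀) hδ
  -- The unit density is the case k = 0 for every τ, so both densities have the same (d-1)-st
  -- derivative at 0.
  have hA := ha.unique (hb (k := 0) hd (by simp) (ConformalDensity.unit c) hunit)
  obtain ⟨C', R, hR, hexp⟩ := exists_expansion_integral_div_pow hd hh hhc
  refine ⟨fun k => (-1) ^ (d - k - 1) / ((Nat.factorial (d - 1 - k) : ℝ) * (k : ℝ)) *
    ((-1) ^ (d - 1 - k) * iteratedDeriv (d - 1 - k) h 0), C + C', R, fun k hk => ?_, hR,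
    fun g ε hε => ConformalDensity.integrableOn_regulatedIntegrand σ hτ hD g hε,
    min t₀ 1, lt_min ht₀ one_pos, fun g ε hε hε₀ => ?_⟩
  · rw [Finset.mem_Icc] at hk
    exact ⟨_, hb (k := k) (by omega) rfl (τ.invPow hτ k) fun x => rfl, rfl⟩
  · obtain ⟨Ω, hΩ⟩ := hg₀ g
    rw [ConformalDensity.regulatedVolume_eq σ hτ hD hΩ,
      hvol ε hε (hε₀.trans_le (min_le_left _ _)), hexp ε hε (hε₀.trans_le (min_le_right _ _)), hA]
    have hsum : ∀ k ∈ Finset.Icc 1 (d - 1),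
        (-1) ^ (d - k - 1) / ((Nat.factorial (d - 1 - k) : ℝ) * (k : ℝ)) *
          ((-1) ^ (d - 1 - k) * iteratedDeriv (d - 1 - k) h 0) * (ε ^ k)⁻¹ =
        iteratedDeriv (d - 1 - k) h 0 / ((d - 1 - k).factorial * (k : ℝ)) * (ε ^ k)⁻¹ := by
      intro k _
      have h2 : (-1 : ℝ) ^ (d - 1 - k) * (-1) ^ (d - 1 - k) = 1 := by
        rw [← mul_pow]; simp
      rw [show d - k - 1 = d - 1 - k by omega, div_mul_eq_mul_div, ← mul_assoc, h2, one_mul]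
    rw [Finset.sum_congr rfl hsum]
    obtain ⟨e, rfl⟩ : ∃ e, d = e + 1 := ⟨d - 1, by omega⟩
    -- The signs (-1)^d and (-1)^(d-1) combine to the minus sign of the logarithm in the model
    -- integral.
    have h3 : (-1 : ℝ) ^ (e + 1) * (-1) ^ e = -1 := by
      rw [pow_succ, mul_right_comm, ← mul_pow]; simp
    simp only [Nat.add_sub_cancel, Nat.sub_zero]
    have h4 : (-1 : ℝ) ^ (e + 1) / (e.factorial : ℝ) * ((-1) ^ e * iteratedDeriv e h 0) =
        -(iteratedDeriv e h 0 / e.factorial) := by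
      rw [div_mul_eq_mul_div, ← mul_assoc, h3]
      ring
    rw [h4]
    ring
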